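/- Let $m=2^n$ and $a\ge 0$ be such that $n+a\ge 1$. A distribution oracle is a unitary $O_D$ on $n+a=\log_2 m+a$ qubits; write $O_D|0^{n+a}\rangle=\sum_{x\in\{0,1\}^n}\alpha_x|x\rangle|\psi_x\rangle$ with unit vectors $|\psi_x\rangle$, and let $p_x=|\alpha_x|^2$ be the probability of observing $x$ when the first $n$ qubits are measured in the standard basis. A quantum query algorithm with $T$ queries on $q$ qubits (these include the $n+a$ qubits on which the oracle acts) starts in $|0^q\rangle$, applies $U_TQ_TU_{T-1}\cdots Q_1U_0$, where the $U_i$ are unitaries on all $q$ qubits that do not depend on $O_D$ and each $Q_i$ applies $O_D$ or $O_D^{-1}$ to $n+a$ of the qubits, and finally measures one output qubit in the standard basis. There is an absolute constant $C>0$ such that for all such $m,a$ and all $\tau\in(0,1)$, $\epsilon_r\in(0,1)$, $\delta\in(0,\tfrac12)$ there is a quantum query algorithm (depending only on $m,a,\tau,\epsilon_r,\delta$, and not on $O_D$) that makes at most $$C\cdot\frac{1}{\epsilon_r\tau^{3/2}}\log_2\frac{1}{\delta\tau}$$ queries, uses at most $$C\cdot\Big(\log_2 m+\log_2\frac{1}{\epsilon_r\tau}+a\Big)\log_2\frac{1}{\delta\tau}$$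 qubits, and, for every oracle $O_D$: 1. if $p_x<(1-\epsilon_r)\tau$ for all $x$, then its output qubit is observed in the state $|0\rangle$ with probability at least $1-\delta$; 2. if $p_x\ge\tau$ for some $x$, then its output qubit is observed in the state $|1\rangle$ with probability at least $1-\delta$. -/

import Mathlib

open scoped Kronecker Matrix

namespace HighDist

/-- Computational basis labels of a register of `k` qubits. -/
abbrev Bits (k : ℕ) : Type := Fin k → Bool

/-- Basis labels of the register on which the oracle acts: `n = log m` index qubits followed by
`a` further qubits. -/
abbrev OracleReg (n a : ℕ) : Type := Bits n × Bits a

/-- Basis labels of the whole memory of an algorithm: the oracle register and `w` work qubits,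
`n + a + w` qubits in total. -/
abbrev Memory (n a w : ℕ) : Type := OracleReg n a × Bits w

/-- An `(n + a)`-qubit distribution oracle: a unitary `O` on `n + a` qubits. -/
abbrev Oracle (n a : ℕ) : Type := Matrix.unitaryGroup (OracleReg n a) ℂ

/-- The all-zero label. -/
def zeros (k : ℕ) : Bits k := fun _ => false

/-- The probability `p_x` of observing `x` when the first `n` qubits of `O |0^{n+a}⟩` are measured
in the standard basis. If `O |0^{n+a}⟩ = ∑ x, α_x |x⟩ |ψ_x⟩` with unit vectors `ψ_x`, this is
`|α_x|²`. -/
noncomputable def outcomeProb {n a : ℕ} (O : Oracle n a) (x : Bits n) : ℝ :=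
  ∑ y : Bits a, ‖(O : Matrix (OracleReg n a) (OracleReg n a) ℂ) (x, y) (zeros n, zeros a)‖ ^ 2

/-- A query is a call to the oracle or to its inverse. -/
inductive Query
  | forward
  | inverse

/-- The operator that a query applies to the whole memory: `O ⊗ I` or `O⁻¹ ⊗ I`. -/
noncomputable def queryOp {n a : ℕ} (w : ℕ) (O : Oracle n a) :
    Query → Matrix (Memory n a w) (Memory n a w) ℂ
  | .forward =>
      (O : Matrix (OracleReg n a) (OracleReg n a) ℂ) ⊗ₖ (1 : Matrix (Bits w) (Bits w) ℂ)
  | .inverse =>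
      (O : Matrix (OracleReg n a) (OracleReg n a) ℂ)ᴴ ⊗ₖ (1 : Matrix (Bits w) (Bits w) ℂ)

/-- A quantum query algorithm `U_T Q_T U_{T-1} ⋯ Q_1 U_0` on `n + a + w` qubits, started in the
all-zero state: the `U_i` are unitaries on the whole memory that do not depend on the oracle, each
`Q_i` is a query, and at the end the work qubit `out` is measured in the standard basis. (The
oracle register can be kept at a fixed place, because the `U_i` may permute the qubits.) -/
structure QueryAlgorithm (n a w : ℕ) where
  initGate : Matrix.unitaryGroup (Memory n a w) ℂ
  steps : List (Query × Matrix.unitaryGroup (Memory n a w) ℂ)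
  out : Fin w

namespace QueryAlgorithm

variable {n a w : ℕ}

/-- The number of queries. -/
def queryCount (A : QueryAlgorithm n a w) : ℕ := A.steps.length

/-- The total number of qubits, those of the oracle register included. -/
def qubitCount (_A : QueryAlgorithm n a w) : ℕ := n + a + w

/-- The state before the final measurement, as a vector of amplitudes. -/
noncomputable def finalState (A : QueryAlgorithm n a w) (O : Oracle n a) : Memory n a w → ℂ :=
  A.steps.foldl
    (fun ψ s =>
      (s.2 : Matrix (Memory n a w) (Memory n a w) ℂ) *ᵥ (queryOp w O s.1 *ᵥ ψ))
    ((A.initGate : Matrix (Memory n a w) (Memory n a w) ℂ) *ᵥ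
      Pi.single ((zeros n, zeros a), zeros w) 1)

/-- The probability that the output qubit is observed in the state `|b⟩`. -/
noncomputable def outputProb (A : QueryAlgorithm n a w) (O : Oracle n a) (b : Bool) : ℝ :=
  ∑ z : Memory n a w with z.2 A.out = b, ‖A.finalState O z‖ ^ 2

/-- The algorithm solves promise HighDist with threshold `τ`, relative accuracy `εr` and error `δ`:
on every oracle with `p_x < (1 - εr) τ` for all `x` it outputs `0`, and on every oracle with
`p_x ≥ τ` for some `x` it outputs `1`, in both cases with probability at least `1 - δ`. -/
def SolvesRelHighDist (A : QueryAlgorithm n a w) (τ εr δ : ℝ) : Prop :=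
  ∀ O : Oracle n a,
    ((∀ x, outcomeProb O x < (1 - εr) * τ) → 1 - δ ≤ A.outputProb O false) ∧
    ((∃ x, τ ≤ outcomeProb O x) → 1 - δ ≤ A.outputProb O true)

end QueryAlgorithm

end HighDist

/-! Draw an outcome `s` with one query, keep it in a separate register, and estimate the amplitude
`√p_s` by phase estimation on the amplitude amplification iterate. Flag `s` if the estimate exceeds
a threshold just below `√τ`. If every misjudgement has probability at most `τ/8`, a run is flagged
with probability at most `τ/8` in the first case. In the second case it is at least `τ/2`, because a
heavy outcome is drawn with probability at least `τ` and then flagged with probability at least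
`1/2`. A second amplitude estimation around this whole procedure tells the amplitudes `√(τ/8)` and
`√(τ/2)` apart, and a majority vote of `r ≈ log (1/δ)` counters makes its error at most `δ`.

A sine window makes the failure probability of phase estimation `O((NΔ)⁻²)` at precision `Δ`
(`sum_windowProb_mul_dist_sq_le`, then Chebyshev). The inner test has `Δ ≈ εr √τ` and error of order
`τ`, so `N₁ ≈ 1/(εr τ)` is enough without repetition. The outer one has constant error per counter,
so `N₂ ≈ 1/√τ`. The query count is of order `r N₁ N₂`.

Eigenvectors never appear: `sum_norm_sq_amplitudeTest` obtains the law of the counter from the Gram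
matrix of the iterates of the start vector. `Implements` keeps account of the queries. -/

namespace HighDist

open Matrix

set_option linter.unusedSectionVars false

/-! ### Unitary matrices -/

section Unitaries

variable {X Y S : Type*} [Fintype X] [DecidableEq X] [Fintype Y] [DecidableEq Y]
  [Fintype S] [DecidableEq S]

/-- The gate that permutes the basis labels, sending the label `σ x` to `x`. -/
def permGate (σ : X ≃ X) : Matrix X X ℂ := (1 : Matrix X X ℂ).submatrix σ id

theorem permGate_mul_apply {Z : Type*} (σ : X ≃ X) (M : Matrix X Z ℂ) (x : X) (z : Z) :
    (permGate σ * M) x z = M (σ x) z := by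
  simp [permGate, Matrix.mul_apply, Matrix.one_apply]

theorem permGate_mem_unitary (σ : X ≃ X) : permGate σ ∈ unitaryGroup X ℂ := by
  rw [mem_unitaryGroup_iff']
  ext x z
  simp [permGate, Matrix.mul_apply, Matrix.one_apply, star_apply]
  rw [Finset.sum_eq_single (σ.symm z)] <;> aesop

/-- The diagonal sign flip of the labels that satisfy `P`. -/
def signFlip (P : X → Prop) [DecidablePred P] : Matrix X X ℂ :=
  diagonal fun x => if P x then -1 else 1

theorem signFlip_conjTranspose (P : X → Prop) [DecidablePred P] :
    (signFlip P)ᴴ = signFlip P := by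
  rw [signFlip, diagonal_conjTranspose]
  congr 1
  ext x
  by_cases h : P x <;> simp [h]

theorem signFlip_mul_self (P : X → Prop) [DecidablePred P] : signFlip P * signFlip P = 1 := by
  rw [signFlip, diagonal_mul_diagonal, ← diagonal_one]
  congr 1
  ext x
  by_cases h : P x <;> simp [h]

theorem signFlip_mem_unitary (P : X → Prop) [DecidablePred P] :
    signFlip P ∈ unitaryGroup X ℂ := by
  rw [mem_unitaryGroup_iff', star_eq_conjTranspose, signFlip_conjTranspose, signFlip_mul_self]

theorem conjTranspose_mul_self_of_mem_unitary {U : Matrix X X ℂ} (hU : U ∈ unitaryGroup X ℂ) :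
    Uᴴ * U = 1 := by
  rw [← star_eq_conjTranspose]
  exact mem_unitaryGroup_iff'.mp hU

theorem mul_conjTranspose_self_of_mem_unitary {U : Matrix X X ℂ} (hU : U ∈ unitaryGroup X ℂ) :
    U * Uᴴ = 1 := by
  rw [← star_eq_conjTranspose]
  exact mem_unitaryGroup_iff.mp hU

theorem mem_unitary_of_conjTranspose_mul_self {U : Matrix X X ℂ} (hU : Uᴴ * U = 1) :
    U ∈ unitaryGroup X ℂ := by
  rw [mem_unitaryGroup_iff', star_eq_conjTranspose, hU]

theorem conjTranspose_mem_unitary {U : Matrix X X ℂ} (hU : U ∈ unitaryGroup X ℂ) :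
    Uᴴ ∈ unitaryGroup X ℂ :=
  mem_unitary_of_conjTranspose_mul_self (by
    rw [conjTranspose_conjTranspose, mul_conjTranspose_self_of_mem_unitary hU])

theorem blockDiagonal_mem_unitary {U : S → Matrix X X ℂ} (hU : ∀ s, U s ∈ unitaryGroup X ℂ) :
    blockDiagonal U ∈ unitaryGroup (X × S) ℂ := by
  apply mem_unitary_of_conjTranspose_mul_self
  rw [blockDiagonal_conjTranspose, ← blockDiagonal_mul, ← blockDiagonal_one]
  congr 1
  ext1 s
  exact conjTranspose_mul_self_of_mem_unitary (hU s)

theorem submatrix_mem_unitary {U : Matrix X X ℂ} (hU : U ∈ unitaryGroup X ℂ) (e : Y ≃ X) :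
    U.submatrix e e ∈ unitaryGroup Y ℂ := by
  apply mem_unitary_of_conjTranspose_mul_self
  rw [conjTranspose_submatrix, submatrix_mul_equiv, conjTranspose_mul_self_of_mem_unitary hU,
    submatrix_one_equiv]

/-- Unitary matrices preserve the sum of the squared absolute values. -/
theorem sum_norm_sq_mulVec {U : Matrix X X ℂ} (hU : U ∈ unitaryGroup X ℂ) (v : X → ℂ) :
    ∑ x, ‖(U *ᵥ v) x‖ ^ 2 = ∑ x, ‖v x‖ ^ 2 := by
  have key (w : X → ℂ) : ((∑ x, ‖w x‖ ^ 2 : ℝ) : ℂ) = star w ⬝ᵥ w := by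
    simp [dotProduct, Complex.conj_mul']
  apply Complex.ofReal_injective
  rw [key, key, star_mulVec, ← dotProduct_mulVec, mulVec_mulVec,
    conjTranspose_mul_self_of_mem_unitary hU, one_mulVec]

theorem sum_norm_sq_column {U : Matrix X X ℂ} (hU : U ∈ unitaryGroup X ℂ) (z : X) :
    ∑ x, ‖U x z‖ ^ 2 = 1 := by
  have h := sum_norm_sq_mulVec hU (Pi.single z 1)
  simp only [mulVec_single_one] at h
  simp only [col_apply] at h
  rw [h, Finset.sum_eq_single z] <;> aesop

/-- Every unit vector is the column of a unitary matrix at any given label. -/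
theorem exists_unitary_column (v : X → ℂ) (hv : ∑ x, ‖v x‖ ^ 2 = 1) (z : X) :
    ∃ U ∈ unitaryGroup X ℂ, ∀ x, U x z = v x := by
  classical
  let u : EuclideanSpace ℂ X := WithLp.toLp 2 v
  have hu : ‖u‖ = 1 := by
    rw [EuclideanSpace.norm_eq, Real.sqrt_eq_one]
    exact hv
  -- Only the restriction of the constant family to the singleton `{z}` has to be orthonormal.
  obtain ⟨b, hb⟩ := Orthonormal.exists_orthonormalBasis_extension_of_card_eq (𝕜 := ℂ)
    (E := EuclideanSpace ℂ X) (ι := X) (by simp) (v := fun _ => u) (s := {z}) (by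
      constructor
      · intro i
        exact hu
      · intro i j hij
        exact absurd (Subsingleton.elim i j) hij)
  refine ⟨Matrix.of fun x y => (b y : EuclideanSpace ℂ X) x, ?_, fun x => ?_⟩
  · apply mem_unitary_of_conjTranspose_mul_self
    ext i j
    have h := orthonormal_iff_ite.mp b.orthonormal i j
    simp only [PiLp.inner_apply, RCLike.inner_apply] at h
    simp only [Matrix.mul_apply, conjTranspose_apply, of_apply, Matrix.one_apply]
    rw [← h]
    exact Finset.sum_congr rfl fun x _ => mul_comm _ _
  · simp [hb z rfl, u]

end Unitaries

/-! ### Operators implemented with a given sequence of queries -/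

section Circuits

variable {Ω X Y S : Type*} [Fintype X] [DecidableEq X] [Fintype Y] [DecidableEq Y]
  [Fintype S] [DecidableEq S]

/-- The operator that a query applies, if a forward query applies `q O`. -/
def applyQuery (q : Ω → Matrix X X ℂ) : Query → Ω → Matrix X X ℂ
  | .forward, O => q O
  | .inverse, O => (q O)ᴴ

/-- `A O` is, for every `O`, a product of unitaries independent of `O` interleaved with the
queries listed in `L`, the first one in the list being applied last. -/
def Implements (q : Ω → Matrix X X ℂ) : List Query → (Ω → Matrix X X ℂ) → Prop
  | [], A => ∃ U ∈ unitaryGroup X ℂ, ∀ O, A O = U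
  | t :: L, A => ∃ U ∈ unitaryGroup X ℂ, ∃ B : Ω → Matrix X X ℂ,
      Implements q L B ∧ ∀ O, A O = U * (applyQuery q t O * B O)

/-- The opposite kind of query. -/
def Query.flip : Query → Query
  | .forward => .inverse
  | .inverse => .forward

/-- The sequence of queries of the inverse operator. -/
def adjointQueries : List Query → List Query
  | [] => []
  | t :: L => adjointQueries L ++ [t.flip]

theorem length_adjointQueries (L : List Query) : (adjointQueries L).length = L.length := by
  induction L with
  | nil => rfl
  | cons t L ih => simp [adjointQueries, ih]

theorem applyQuery_conjTranspose (q : Ω → Matrix X X ℂ) (t : Query) (O : Ω) :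
    (applyQuery q t O)ᴴ = applyQuery q t.flip O := by
  cases t <;> simp [applyQuery, Query.flip]

theorem Implements.gate {q : Ω → Matrix X X ℂ} {U : Matrix X X ℂ} (hU : U ∈ unitaryGroup X ℂ) :
    Implements q [] fun _ => U :=
  ⟨U, hU, fun _ => rfl⟩

theorem Implements.query (q : Ω → Matrix X X ℂ) : Implements q [.forward] q :=
  ⟨1, one_mem _, fun _ => 1, .gate (one_mem _), fun O => by simp [applyQuery]⟩

theorem Implements.gate_mul {q : Ω → Matrix X X ℂ} {L : List Query} {A : Ω → Matrix X X ℂ}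
    {U : Matrix X X ℂ} (hU : U ∈ unitaryGroup X ℂ) (hA : Implements q L A) :
    Implements q L fun O => U * A O := by
  cases L with
  | nil =>
    obtain ⟨W, hW, h⟩ := hA
    exact ⟨U * W, mul_mem hU hW, fun O => by simp only [h]⟩
  | cons t L =>
    obtain ⟨W, hW, B, hB, h⟩ := hA
    exact ⟨U * W, mul_mem hU hW, B, hB, fun O => by simp only [h, Matrix.mul_assoc]⟩

theorem Implements.mul {q : Ω → Matrix X X ℂ} {L M : List Query} {A B : Ω → Matrix X X ℂ}
    (hA : Implements q L A) (hB : Implements q M B) :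
    Implements q (L ++ M) fun O => A O * B O := by
  induction L generalizing A with
  | nil =>
    obtain ⟨U, hU, h⟩ := hA
    simpa only [h, List.nil_append] using hB.gate_mul hU
  | cons t L ih =>
    obtain ⟨U, hU, A', hA', h⟩ := hA
    exact ⟨U, hU, _, ih hA', fun O => by simp only [h, Matrix.mul_assoc]⟩

theorem Implements.adjoint {q : Ω → Matrix X X ℂ} {L : List Query} {A : Ω → Matrix X X ℂ}
    (hA : Implements q L A) : Implements q (adjointQueries L) fun O => (A O)ᴴ := by
  induction L generalizing A with
  | nil =>
    obtain ⟨U, hU, h⟩ := hA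
    exact ⟨Uᴴ, conjTranspose_mem_unitary hU, fun O => by simp only [h]⟩
  | cons t L ih =>
    obtain ⟨U, hU, B, hB, h⟩ := hA
    have hq : Implements q [t.flip] fun O => applyQuery q t.flip O * Uᴴ :=
      ⟨1, one_mem _, fun _ => Uᴴ, .gate (conjTranspose_mem_unitary hU), fun O => by simp⟩
    simpa only [adjointQueries, h, conjTranspose_mul, applyQuery_conjTranspose, Matrix.mul_assoc]
      using (ih hB).mul hq

/-- This is control by the register `S`. Queries themselves are not controlled, so all branches must
share one list `L`; they may differ only in the gates between the queries. -/
theorem Implements.blockDiagonal {q : Ω → Matrix X X ℂ} {L : List Query}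
    {A : S → Ω → Matrix X X ℂ} (hA : ∀ s, Implements q L (A s)) :
    Implements (fun O => blockDiagonal fun _ : S => q O) L
      fun O => Matrix.blockDiagonal fun s => A s O := by
  induction L generalizing A with
  | nil =>
    choose U hU h using hA
    exact ⟨_, blockDiagonal_mem_unitary hU, fun O => by simp only [h]⟩
  | cons t L ih =>
    choose U hU B hB h using hA
    refine ⟨_, blockDiagonal_mem_unitary hU, _, ih hB, fun O => ?_⟩
    have hq : applyQuery (fun O => Matrix.blockDiagonal fun _ : S => q O) t O =
        Matrix.blockDiagonal fun _ : S => applyQuery q t O := by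
      cases t <;> simp [applyQuery, blockDiagonal_conjTranspose]
    simp only [h, hq, ← blockDiagonal_mul]

theorem Implements.submatrix {q : Ω → Matrix X X ℂ} {L : List Query} {A : Ω → Matrix X X ℂ}
    (hA : Implements q L A) (e : Y ≃ X) :
    Implements (fun O => (q O).submatrix e e) L fun O => (A O).submatrix e e := by
  induction L generalizing A with
  | nil =>
    obtain ⟨U, hU, h⟩ := hA
    exact ⟨_, submatrix_mem_unitary hU e, fun O => by simp only [h]⟩
  | cons t L ih =>
    obtain ⟨U, hU, B, hB, h⟩ := hA
    refine ⟨_, submatrix_mem_unitary hU e, _, ih hB, fun O => ?_⟩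
    have hq : applyQuery (fun O => (q O).submatrix e e) t O =
        (applyQuery q t O).submatrix e e := by
      cases t <;> simp [applyQuery, conjTranspose_submatrix]
    simp only [h, hq, submatrix_mul_equiv]

theorem Implements.mem_unitary {q : Ω → Matrix X X ℂ} (hq : ∀ O, q O ∈ unitaryGroup X ℂ)
    {L : List Query} {A : Ω → Matrix X X ℂ} (hA : Implements q L A) (O : Ω) :
    A O ∈ unitaryGroup X ℂ := by
  induction L generalizing A with
  | nil =>
    obtain ⟨U, hU, h⟩ := hA
    rwa [h]
  | cons t L ih =>
    obtain ⟨U, hU, B, hB, h⟩ := hA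
    rw [h]
    refine mul_mem hU (mul_mem ?_ (ih hB))
    cases t
    · exact hq O
    · exact conjTranspose_mem_unitary (hq O)

end Circuits

/-! ### From implemented operators to query algorithms -/

section Algorithms

variable {n a : ℕ}

theorem Implements.exists_algorithm {w : ℕ} {L : List Query}
    {A : Oracle n a → Matrix (Memory n a w) (Memory n a w) ℂ}
    (hA : Implements (queryOp w · .forward) L A) (out : Fin w) :
    ∃ B : QueryAlgorithm n a w, B.queryCount = L.length ∧ B.out = out ∧
      ∀ O z, B.finalState O z = A O z ((zeros n, zeros a), zeros w) := by
  suffices h : ∃ B : QueryAlgorithm n a w, B.queryCount = L.length ∧ B.out = out ∧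
      ∀ O, B.finalState O = A O *ᵥ Pi.single ((zeros n, zeros a), zeros w) 1 by
    obtain ⟨B, h₁, h₂, h₃⟩ := h
    exact ⟨B, h₁, h₂, fun O z => by simp [h₃]⟩
  induction L generalizing A with
  | nil =>
    obtain ⟨U, hU, h⟩ := hA
    exact ⟨⟨⟨U, hU⟩, [], out⟩, rfl, rfl, fun O => by simp [QueryAlgorithm.finalState, h]⟩
  | cons t L ih =>
    obtain ⟨U, hU, A', hA', h⟩ := hA
    obtain ⟨B, h₁, h₂, h₃⟩ := ih hA'
    -- The head of `L` is applied last, whereas `steps` runs from the left, so the new step goes at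
    -- the end.
    refine ⟨⟨B.initGate, B.steps ++ [(t, ⟨U, hU⟩)], out⟩, ?_, rfl, fun O => ?_⟩
    · simpa [QueryAlgorithm.queryCount] using h₁
    · have hq : applyQuery (queryOp w · .forward) t O = queryOp w O t := by
        cases t
        · rfl
        · simp [applyQuery, queryOp, conjTranspose_kronecker]
      have hB := h₃ O
      simp only [QueryAlgorithm.finalState] at hB ⊢
      rw [List.foldl_append, hB]
      simp only [List.foldl_cons, List.foldl_nil, h, hq, mulVec_mulVec, Matrix.mul_assoc]

/-- An operator implemented on the oracle register together with a work register with `2 ^ w`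
labels gives an algorithm with `w + 1` work qubits whose output is the truth value of `P`. -/
theorem Implements.exists_algorithm_of_card {W : Type*} [Fintype W] [DecidableEq W] {w : ℕ}
    (hW : Fintype.card W = 2 ^ w) {L : List Query}
    {A : Oracle n a → Matrix (OracleReg n a × W) (OracleReg n a × W) ℂ}
    (hA : Implements (fun O : Oracle n a => Matrix.blockDiagonal fun _ : W =>
      (O : Matrix (OracleReg n a) (OracleReg n a) ℂ)) L A)
    (w₀ : W) (P : OracleReg n a × W → Prop) [DecidablePred P] :
    ∃ B : QueryAlgorithm n a (w + 1), B.queryCount = L.length ∧ ∀ O b,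
      B.outputProb O b =
        ∑ z with decide (P z) = b, ‖A O z ((zeros n, zeros a), w₀)‖ ^ 2 := by
  obtain ⟨e⟩ : Nonempty (W ≃ Bits w) := Fintype.card_eq.mp (by simp [hW])
  -- The swap makes the start label `w₀` correspond to the all-zero string.
  let e₀ : W ≃ Bits w := e.trans (Equiv.swap (e w₀) (zeros w))
  have he₀ : e₀ w₀ = zeros w := by simp [e₀]
  let f : W × Bool ≃ Bits (w + 1) :=
    ((Equiv.prodComm _ _).trans (Equiv.prodCongr (Equiv.refl _) e₀)).trans
      (Fin.consEquiv fun _ => Bool)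
  let g : (OracleReg n a × W) × Bool ≃ Memory n a (w + 1) :=
    (Equiv.prodAssoc _ _ _).trans (Equiv.prodCongr (Equiv.refl _) f)
  have hg₀ : g (((zeros n, zeros a), w₀), false) = ((zeros n, zeros a), zeros (w + 1)) := by
    refine Prod.ext rfl ?_
    ext i
    refine Fin.cases ?_ (fun j => ?_) i
    · rfl
    · change e₀ w₀ j = _
      rw [he₀]
      rfl
  have hgout (z : (OracleReg n a × W) × Bool) : (g z).2 0 = z.2 := rfl
  -- The truth value of `P` is XORed into the extra qubit, which starts at `false` and sits at
  -- position `0`.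
  let σ : (OracleReg n a × W) × Bool ≃ (OracleReg n a × W) × Bool :=
    Function.Involutive.toPerm (fun z => (z.1, xor z.2 (decide (P z.1)))) (by
      intro z
      simp)
  have hM := ((Implements.blockDiagonal (S := Bool) (A := fun _ => A) fun _ => hA).gate_mul
    (permGate_mem_unitary σ)).submatrix g.symm
  have hq : (fun O : Oracle n a => (Matrix.blockDiagonal fun _ : Bool =>
      Matrix.blockDiagonal fun _ : W =>
        (O : Matrix (OracleReg n a) (OracleReg n a) ℂ)).submatrix g.symm g.symm) =
      (queryOp (w + 1) · .forward) := by
    ext O x y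
    obtain ⟨x, rfl⟩ := g.surjective x
    obtain ⟨y, rfl⟩ := g.surjective y
    obtain ⟨⟨x, u⟩, b⟩ := x
    obtain ⟨⟨y, v⟩, c⟩ := y
    have hfg : ((g ((x, u), b)).2 = (g ((y, v), c)).2) ↔ u = v ∧ b = c := by
      change f (u, b) = f (v, c) ↔ _
      rw [f.injective.eq_iff, Prod.ext_iff]
    simp only [submatrix_apply, Equiv.symm_apply_apply, queryOp, kronecker_one,
      blockDiagonal_apply, hfg]
    change _ = if u = v ∧ b = c then (O : Matrix (OracleReg n a) (OracleReg n a) ℂ) x y else 0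
    by_cases h₁ : u = v <;> by_cases h₂ : b = c <;> simp [h₁, h₂]
  rw [hq] at hM
  obtain ⟨B, h₁, h₂, h₃⟩ := hM.exists_algorithm 0
  refine ⟨B, h₁, fun O b => ?_⟩
  rw [QueryAlgorithm.outputProb, Finset.sum_filter, Finset.sum_filter, ← g.sum_comp,
    Fintype.sum_prod_type]
  refine Finset.sum_congr rfl fun z _ => ?_
  have hval (c : Bool) : B.finalState O (g (z, c)) =
      if c = decide (P z) then A O z ((zeros n, zeros a), w₀) else 0 := by
    rw [h₃, ← hg₀]
    simp only [submatrix_apply, Equiv.symm_apply_apply, permGate_mul_apply]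
    change Matrix.blockDiagonal (fun _ : Bool => A O) (z, xor c (decide (P z))) _ = _
    rw [blockDiagonal_apply]
    cases c <;> cases decide (P z) <;> simp
  simp only [h₂, hgout, hval, Fintype.sum_bool]
  by_cases h : P z <;> cases b <;> simp [h]

end Algorithms

/-! ### Amplitude tests -/

section Tests

variable {Ω X K : Type*} [Fintype X] [DecidableEq X] [Fintype K] [DecidableEq K]

/-- The probability of observing a label in `P` after applying `V` to the label `x₀`. -/
noncomputable def hitProb (V : Matrix X X ℂ) (P : X → Prop) [DecidablePred P] (x₀ : X) : ℝ :=
  ∑ x with P x, ‖V x x₀‖ ^ 2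

theorem hitProb_nonneg (V : Matrix X X ℂ) (P : X → Prop) [DecidablePred P] (x₀ : X) :
    0 ≤ hitProb V P x₀ :=
  Finset.sum_nonneg fun _ _ => by positivity

theorem hitProb_add_not {V : Matrix X X ℂ} (hV : V ∈ unitaryGroup X ℂ) (P : X → Prop)
    [DecidablePred P] (x₀ : X) : hitProb V P x₀ + hitProb V (fun x => ¬ P x) x₀ = 1 := by
  rw [hitProb, hitProb, Finset.sum_filter_add_sum_filter_not, sum_norm_sq_column hV]

theorem hitProb_le_one {V : Matrix X X ℂ} (hV : V ∈ unitaryGroup X ℂ) (P : X → Prop)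
    [DecidablePred P] (x₀ : X) : hitProb V P x₀ ≤ 1 := by
  have h₁ := hitProb_add_not hV P x₀
  have h₂ := hitProb_nonneg V (fun x => ¬ P x) x₀
  linarith

/-- The amplitude amplification iterate. -/
def grover (V : Matrix X X ℂ) (P : X → Prop) [DecidablePred P] (x₀ : X) : Matrix X X ℂ :=
  signFlip (· ≠ x₀) * (Vᴴ * signFlip P * V)

theorem grover_mem_unitary {V : Matrix X X ℂ} (hV : V ∈ unitaryGroup X ℂ) (P : X → Prop)
    [DecidablePred P] (x₀ : X) : grover V P x₀ ∈ unitaryGroup X ℂ :=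
  mul_mem (signFlip_mem_unitary _)
    (mul_mem (mul_mem (conjTranspose_mem_unitary hV) (signFlip_mem_unitary _)) hV)

/-- The entry is the expectation of an observable with value `-1` on `P` and `1` off `P`. -/
theorem conj_signFlip_apply {V : Matrix X X ℂ} (hV : V ∈ unitaryGroup X ℂ) (P : X → Prop)
    [DecidablePred P] (x₀ : X) :
    (Vᴴ * signFlip P * V) x₀ x₀ = ((1 - 2 * hitProb V P x₀ : ℝ) : ℂ) := by
  have h : (Vᴴ * signFlip P * V) x₀ x₀ =
      ((∑ x, (if P x then -1 else 1) * ‖V x x₀‖ ^ 2 : ℝ) : ℂ) := by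
    rw [signFlip, Matrix.mul_apply]
    push_cast
    refine Finset.sum_congr rfl fun x _ => ?_
    rw [mul_diagonal, conjTranspose_apply, ← Complex.conj_mul']
    simp only [RCLike.star_def]
    split_ifs <;> push_cast <;> ring
  have h' : ∑ x, (if P x then -1 else 1) * ‖V x x₀‖ ^ 2 =
      hitProb V (fun x => ¬ P x) x₀ - hitProb V P x₀ := by
    rw [hitProb, hitProb, Finset.sum_filter, Finset.sum_filter, ← Finset.sum_sub_distrib]
    refine Finset.sum_congr rfl fun x _ => ?_
    by_cases hx : P x <;> simp [hx]
  rw [h, h', ← hitProb_add_not hV P x₀]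
  congr 1
  ring

/-- The iterate `G = R * S` is a product of two reflections, so `G⁻¹ = S * R`. Since `G + G⁻¹`
multiplies the basis vector of `x₀` by `2 cos θ`, the entries satisfy the Chebyshev recursion. No
case distinction for degenerate `θ` is needed. -/
theorem grover_pow_apply {V : Matrix X X ℂ} (hV : V ∈ unitaryGroup X ℂ) (P : X → Prop)
    [DecidablePred P] (x₀ : X) {θ : ℝ} (hθ : Real.cos θ = 1 - 2 * hitProb V P x₀) (m : ℕ) :
    (grover V P x₀ ^ m) x₀ x₀ = (Real.cos (m * θ) : ℂ) := by
  set S := Vᴴ * signFlip P * V with hS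
  set R : Matrix X X ℂ := signFlip (· ≠ x₀) with hR
  have hc : S x₀ x₀ = (Real.cos θ : ℂ) := by rw [hS, conj_signFlip_apply hV, hθ]
  have hG : grover V P x₀ = R * S := rfl
  have hSS : S * S = 1 := by
    calc S * S = Vᴴ * signFlip P * (V * Vᴴ) * signFlip P * V := by
          simp only [hS, Matrix.mul_assoc]
      _ = 1 := by
        rw [mul_conjTranspose_self_of_mem_unitary hV, Matrix.mul_one, Matrix.mul_assoc Vᴴ,
          signFlip_mul_self, Matrix.mul_one, conjTranspose_mul_self_of_mem_unitary hV]
  have hinv : R * S * (S * R) = 1 := by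
    rw [Matrix.mul_assoc, ← Matrix.mul_assoc S, hSS, Matrix.one_mul, hR, signFlip_mul_self]
  have hcol (j : X) : (R * S + S * R) j x₀ = if j = x₀ then 2 * (Real.cos θ : ℂ) else 0 := by
    rw [Matrix.add_apply, hR, signFlip, diagonal_mul, mul_diagonal]
    by_cases hj : j = x₀
    · subst hj
      simp only [hc]
      simp
      ring
    · simp [hj]
  have hstep (m : ℕ) : (grover V P x₀ ^ (m + 2)) x₀ x₀ + (grover V P x₀ ^ m) x₀ x₀ =
      2 * (Real.cos θ : ℂ) * (grover V P x₀ ^ (m + 1)) x₀ x₀ := by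
    have h : grover V P x₀ ^ (m + 2) + grover V P x₀ ^ m =
        grover V P x₀ ^ (m + 1) * (R * S + S * R) := by
      rw [mul_add, ← hG, ← pow_succ, pow_succ (grover V P x₀) m, Matrix.mul_assoc, hG, hinv,
        Matrix.mul_one]
    rw [← Matrix.add_apply, h, Matrix.mul_apply]
    simp only [hcol, mul_ite, mul_zero, Finset.sum_ite_eq', Finset.mem_univ, if_true]
    ring
  induction m using Nat.twoStepInduction with
  | zero => simp
  | one =>
    rw [pow_one, hG, hR, signFlip, diagonal_mul, hc]
    simp
  | more m ih₀ ih₁ =>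
    have h := hstep m
    rw [ih₀, ih₁] at h
    rw [eq_sub_of_add_eq h]
    have htrig : Real.cos (((m + 2 : ℕ) : ℝ) * θ) =
        2 * Real.cos θ * Real.cos (((m + 1 : ℕ) : ℝ) * θ) - Real.cos (m * θ) := by
      have h₁ : ((m + 2 : ℕ) : ℝ) * θ = ((m + 1 : ℕ) : ℝ) * θ + θ := by push_cast; ring
      have h₂ : (m : ℝ) * θ = ((m + 1 : ℕ) : ℝ) * θ - θ := by push_cast; ring
      rw [h₁, h₂, Real.cos_add, Real.cos_sub]
      ring
    rw [htrig]
    push_cast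
    ring

theorem sum_conj_grover_pow_mul {V : Matrix X X ℂ} (hV : V ∈ unitaryGroup X ℂ) (P : X → Prop)
    [DecidablePred P] (x₀ : X) {θ : ℝ} (hθ : Real.cos θ = 1 - 2 * hitProb V P x₀) (l m : ℕ) :
    ∑ x, star ((grover V P x₀ ^ l) x x₀) * (grover V P x₀ ^ m) x x₀ =
      (Real.cos ((m - l : ℝ) * θ) : ℂ) := by
  have hle (l k : ℕ) : ∑ x, star ((grover V P x₀ ^ l) x x₀) * (grover V P x₀ ^ (l + k)) x x₀ =
      (Real.cos (k * θ) : ℂ) := by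
    have h : (grover V P x₀ ^ l)ᴴ * grover V P x₀ ^ (l + k) = grover V P x₀ ^ k := by
      rw [pow_add, ← Matrix.mul_assoc,
        conjTranspose_mul_self_of_mem_unitary (pow_mem (grover_mem_unitary hV P x₀) l),
        Matrix.one_mul]
    rw [← grover_pow_apply hV P x₀ hθ, ← h, Matrix.mul_apply]
    rfl
  rcases le_total l m with h | h
  · obtain ⟨k, rfl⟩ := Nat.exists_eq_add_of_le h
    rw [hle]
    push_cast
    congr 2
    ring
  · obtain ⟨k, rfl⟩ := Nat.exists_eq_add_of_le h
    have h₁ := congrArg star (hle m k)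
    rw [star_sum] at h₁
    simp only [star_mul', star_star] at h₁
    rw [Finset.sum_congr rfl fun x _ => mul_comm _ _, h₁, Complex.star_def, Complex.conj_ofReal,
      ← Real.cos_neg]
    push_cast
    congr 2
    ring

/-- Prepare the counter with `C`, apply the amplitude amplification iterate `m k` times if the
counter is `k`, and apply `F` to the counter. -/
noncomputable def amplitudeTest (F C : Matrix K K ℂ) (m : K → ℕ) (V : Matrix X X ℂ)
    (P : X → Prop) [DecidablePred P] (x₀ : X) : Matrix (X × K) (X × K) ℂ :=
  ((1 : Matrix X X ℂ) ⊗ₖ F) * (blockDiagonal fun k => grover V P x₀ ^ m k) *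
    ((1 : Matrix X X ℂ) ⊗ₖ C)

theorem amplitudeTest_apply (F C : Matrix K K ℂ) (m : K → ℕ) (V : Matrix X X ℂ)
    (P : X → Prop) [DecidablePred P] (x₀ x : X) (y k₀ : K) :
    amplitudeTest F C m V P x₀ (x, y) (x₀, k₀) =
      ∑ k, F y k * C k k₀ * (grover V P x₀ ^ m k) x x₀ := by
  simp only [amplitudeTest, Matrix.mul_apply, Fintype.sum_prod_type, kroneckerMap_apply,
    blockDiagonal_apply, Matrix.one_apply]
  simp [Finset.sum_ite_eq, mul_ite, ite_mul]
  refine Finset.sum_congr rfl fun k _ => ?_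
  ring

/-- The probability that the counter is `y` when the eigenphase of the iterate is `φ`. -/
noncomputable def phaseProb (F : Matrix K K ℂ) (c : K → ℂ) (m : K → ℕ) (φ : ℝ) (y : K) : ℝ :=
  ‖(F *ᵥ fun k => c k * Complex.exp (φ * Complex.I) ^ m k) y‖ ^ 2

theorem ofReal_norm_sq_sum (v : K → ℂ) :
    ((‖∑ k, v k‖ ^ 2 : ℝ) : ℂ) = ∑ k, ∑ l, star (v k) * v l := by
  push_cast
  rw [← Complex.conj_mul', map_sum, Finset.sum_mul_sum]
  rfl

/-- The Gram matrix `cos ((m l - m k) θ)` of the iterates is the mean of the rank-one matrices of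
the phases `θ` and `-θ`. So the counter behaves as if the start vector were an equal mixture of two
eigenvectors. -/
theorem sum_norm_sq_amplitudeTest (F C : Matrix K K ℂ) (m : K → ℕ) {V : Matrix X X ℂ}
    (hV : V ∈ unitaryGroup X ℂ) (P : X → Prop) [DecidablePred P] (x₀ : X) {θ : ℝ}
    (hθ : Real.cos θ = 1 - 2 * hitProb V P x₀) (y k₀ : K) :
    ∑ x, ‖amplitudeTest F C m V P x₀ (x, y) (x₀, k₀)‖ ^ 2 =
      (phaseProb F (C · k₀) m θ y + phaseProb F (C · k₀) m (-θ) y) / 2 := by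
  have hphase (φ : ℝ) : (phaseProb F (C · k₀) m φ y : ℂ) =
      ∑ k, ∑ l, star (F y k * C k k₀) * (F y l * C l k₀) *
        Complex.exp ((((m l : ℝ) - m k) * φ : ℝ) * Complex.I) := by
    rw [phaseProb, mulVec, dotProduct, ofReal_norm_sq_sum]
    refine Finset.sum_congr rfl fun k _ => Finset.sum_congr rfl fun l _ => ?_
    have h : Complex.exp ((((m l : ℝ) - m k) * φ : ℝ) * Complex.I) =
        star (Complex.exp (φ * Complex.I) ^ m k) * Complex.exp (φ * Complex.I) ^ m l := by
      rw [← Complex.exp_nat_mul, ← Complex.exp_nat_mul, Complex.star_def, ← Complex.exp_conj,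
        ← Complex.exp_add]
      congr 1
      simp only [map_mul, Complex.conj_ofReal, Complex.conj_I, map_natCast]
      push_cast
      ring
    rw [h]
    simp only [star_mul']
    ring
  have hsum : ((∑ x, ‖amplitudeTest F C m V P x₀ (x, y) (x₀, k₀)‖ ^ 2 : ℝ) : ℂ) =
      ∑ k, ∑ l, star (F y k * C k k₀) * (F y l * C l k₀) *
        (Real.cos (((m l : ℝ) - m k) * θ) : ℂ) := by
    simp only [amplitudeTest_apply]
    rw [Complex.ofReal_sum]
    simp only [ofReal_norm_sq_sum]
    rw [Finset.sum_comm]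
    refine Finset.sum_congr rfl fun k _ => ?_
    rw [Finset.sum_comm]
    refine Finset.sum_congr rfl fun l _ => ?_
    rw [← sum_conj_grover_pow_mul hV P x₀ hθ, Finset.mul_sum]
    refine Finset.sum_congr rfl fun x _ => ?_
    simp only [star_mul']
    ring
  apply Complex.ofReal_injective
  rw [hsum]
  push_cast
  rw [hphase, hphase, ← Finset.sum_add_distrib, Finset.sum_div]
  refine Finset.sum_congr rfl fun k _ => ?_
  rw [← Finset.sum_add_distrib, Finset.sum_div]
  refine Finset.sum_congr rfl fun l _ => ?_
  rw [Complex.cos]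
  push_cast
  rw [show -(((m l : ℂ) - m k) * θ) * Complex.I = ((m l : ℂ) - m k) * -θ * Complex.I by ring]
  ring

/-- The queries of `T` controlled iterations of amplitude amplification. -/
def testQueries (L : List Query) : ℕ → List Query
  | 0 => []
  | T + 1 => adjointQueries L ++ L ++ testQueries L T

theorem length_testQueries (L : List Query) (T : ℕ) :
    (testQueries L T).length = T * (2 * L.length) := by
  induction T with
  | zero => simp [testQueries]
  | succ T ih =>
    simp only [testQueries, List.length_append, length_adjointQueries, ih]
    ring

/-- Only the sign flips are controlled by the counter. In a round beyond `m k` both are replaced by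
the identity, so the queries of `A` and its adjoint cancel while the query sequence stays the same
for every `k`. -/
theorem Implements.amplitudeTest {q : Ω → Matrix X X ℂ} {L : List Query}
    {A : Ω → Matrix X X ℂ} (hA : Implements q L A) (hu : ∀ O, A O ∈ unitaryGroup X ℂ)
    {F C : Matrix K K ℂ} (hF : F ∈ unitaryGroup K ℂ) (hC : C ∈ unitaryGroup K ℂ)
    {m : K → ℕ} {T : ℕ} (hm : ∀ k, m k ≤ T) (P : X → Prop) [DecidablePred P] (x₀ : X) :
    Implements (fun O => Matrix.blockDiagonal fun _ : K => q O) (testQueries L T)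
      fun O => HighDist.amplitudeTest F C m (A O) P x₀ := by
  have hctrl (b : K → Prop) [DecidablePred b] (Q : X → Prop) [DecidablePred Q] :
      (Matrix.blockDiagonal fun k => if b k then signFlip Q else 1) ∈ unitaryGroup (X × K) ℂ :=
    blockDiagonal_mem_unitary fun k => by
      split_ifs
      · exact signFlip_mem_unitary Q
      · exact one_mem _
  have hA' := Implements.blockDiagonal (S := K) fun _ => hA
  have hpow (T : ℕ) : Implements (fun O => Matrix.blockDiagonal fun _ : K => q O)
      (testQueries L T)
      fun O => Matrix.blockDiagonal fun k => grover (A O) P x₀ ^ min (m k) T := by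
    induction T with
    | zero =>
      simp only [Nat.min_zero, pow_zero]
      exact .gate (blockDiagonal_mem_unitary fun _ => one_mem _)
    | succ T ih =>
      have h := ((hA'.adjoint.mul (hA'.gate_mul (hctrl (T < m ·) P))).gate_mul
        (hctrl (T < m ·) (· ≠ x₀))).mul ih
      rw [testQueries]
      convert h using 2 with O
      rw [blockDiagonal_conjTranspose]
      simp only [← blockDiagonal_mul]
      congr 1
      ext1 k
      by_cases hk : T < m k
      · rw [min_eq_right (Nat.succ_le_of_lt hk), min_eq_right hk.le, pow_succ']
        simp only [hk, if_true, grover, Matrix.mul_assoc]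
      · rw [min_eq_left (by lia), min_eq_left (by lia)]
        simp [hk, conjTranspose_mul_self_of_mem_unitary (hu O)]
  have h := (hpow T).gate_mul (Matrix.kronecker_mem_unitary (one_mem (unitaryGroup X ℂ)) hF)
  have h' := h.mul (.gate (Matrix.kronecker_mem_unitary (one_mem (unitaryGroup X ℂ)) hC))
  rw [List.append_nil] at h'
  simpa only [HighDist.amplitudeTest, min_eq_left (hm _)] using h'

end Tests

/-! ### Phase estimation with a sine window -/

section PhaseEstimation

variable {N : ℕ} [NeZero N]

/-- The inverse discrete Fourier transform, normalized to be unitary. -/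
noncomputable def dftGate (N : ℕ) [NeZero N] : Matrix (ZMod N) (ZMod N) ℂ :=
  Matrix.of fun y k => ((√N)⁻¹ : ℝ) * ZMod.stdAddChar (-(y * k))

theorem dftGate_mem_unitary : dftGate N ∈ unitaryGroup (ZMod N) ℂ := by
  apply mem_unitary_of_conjTranspose_mul_self
  ext k l
  have hN : (0 : ℝ) < N := Nat.cast_pos.mpr (NeZero.pos N)
  have h : ((√N)⁻¹ : ℝ) * ((√N)⁻¹ : ℝ) = (N : ℝ)⁻¹ := by
    rw [← mul_inv, Real.mul_self_sqrt hN.le]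
  have hterm (y : ZMod N) : (dftGate N)ᴴ k y * dftGate N y l =
      ((N : ℝ)⁻¹ : ℝ) * ZMod.stdAddChar (y * (k - l)) := by
    rw [← h, mul_sub, sub_eq_add_neg, AddChar.map_add_eq_mul]
    simp only [dftGate, conjTranspose_apply, of_apply, star_mul', Complex.star_def,
      Complex.conj_ofReal, ← AddChar.map_neg_eq_conj, neg_neg]
    push_cast
    ring
  rw [Matrix.mul_apply]
  simp only [hterm]
  rw [← Finset.mul_sum, AddChar.sum_mulShift _ (ZMod.isPrimitive_stdAddChar N), ZMod.card,
    Matrix.one_apply]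
  simp only [sub_eq_zero]
  split_ifs
  · push_cast
    exact inv_mul_cancel₀ (by exact_mod_cast hN.ne')
  · simp

/-- The sine window. -/
noncomputable def sineWindow (N : ℕ) (k : ZMod N) : ℝ := √(2 / N) * Real.sin (Real.pi * k.val / N)

/-- By the double angle formula this reduces to the vanishing sum of a nontrivial character, which
is why `N ≥ 2` is needed. -/
theorem sum_sineWindow_sq (hN : 2 ≤ N) : ∑ k, sineWindow N k ^ 2 = 1 := by
  have hN₀ : (0 : ℝ) < N := by positivity
  have hcos (k : ZMod N) : (ZMod.stdAddChar k : ℂ).re = Real.cos (2 * (Real.pi * k.val / N)) := by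
    rw [ZMod.stdAddChar_apply, ZMod.toCircle_eq_circleExp, Circle.coe_exp,
      Complex.exp_ofReal_mul_I_re]
    congr 1
    ring
  have hsum : ∑ k : ZMod N, Real.cos (2 * (Real.pi * k.val / N)) = 0 := by
    have h := AddChar.sum_mulShift (1 : ZMod N) (ZMod.isPrimitive_stdAddChar N)
    have : Fact (1 < N) := ⟨hN⟩
    rw [if_neg one_ne_zero] at h
    simp only [mul_one] at h
    simp only [← hcos, ← Complex.re_sum, h]
    simp
  have hterm (k : ZMod N) : sineWindow N k ^ 2 =
      (N : ℝ)⁻¹ * (1 - Real.cos (2 * (Real.pi * k.val / N))) := by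
    rw [sineWindow, mul_pow, Real.sq_sqrt (by positivity), Real.cos_two_mul, Real.cos_sq']
    field_simp
    ring
  simp only [hterm]
  rw [← Finset.mul_sum, Finset.sum_sub_distrib, hsum]
  simp [ZMod.card, hN₀.ne']

/-- The probability that phase estimation with the sine window returns `y` on the eigenphase `φ`. -/
noncomputable def windowProb (N : ℕ) [NeZero N] (φ : ℝ) (y : ZMod N) : ℝ :=
  phaseProb (dftGate N) (fun k => (sineWindow N k : ℂ)) ZMod.val φ y

theorem windowProb_nonneg (φ : ℝ) (y : ZMod N) : 0 ≤ windowProb N φ y := by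
  rw [windowProb, phaseProb]
  positivity

theorem sum_windowProb (hN : 2 ≤ N) (φ : ℝ) : ∑ y, windowProb N φ y = 1 := by
  simp only [windowProb, phaseProb]
  rw [sum_norm_sq_mulVec dftGate_mem_unitary, ← sum_sineWindow_sq hN]
  simp [Complex.norm_exp_ofReal_mul_I]

/-- Away from `0` the phases cancel and the sine is 1-Lipschitz. At the wrap-around the phases do
not match, but the window is zero at `0` and only `√(2/N) sin (π/N)` at `N - 1`. -/
theorem norm_windowed_sub_le (hN : 2 ≤ N) (φ : ℝ) (k : ZMod N) :
    ‖(sineWindow N k * Complex.exp (φ * Complex.I) ^ k.val -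
      Complex.exp (φ * Complex.I) *
        (sineWindow N (k - 1) * Complex.exp (φ * Complex.I) ^ (k - 1).val) : ℂ)‖ ≤
      √(2 / N) * (Real.pi / N) := by
  have hN₀ : (0 : ℝ) < N := by positivity
  have : Fact (1 < N) := ⟨hN⟩
  have hpi := Real.pi_pos
  by_cases hk : k = 0
  · subst hk
    have h₁ : (0 - 1 : ZMod N).val = N - 1 := by
      obtain ⟨M, rfl⟩ : ∃ M, N = M + 1 := ⟨N - 1, by lia⟩
      rw [zero_sub, ZMod.val_neg_one]
      rfl
    have h₂ : Real.pi * ((N - 1 : ℕ) : ℝ) / N = Real.pi - Real.pi / N := by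
      rw [Nat.cast_sub (by lia)]
      field_simp
      simp
    simp only [sineWindow, h₁, h₂, Real.sin_pi_sub, ZMod.val_zero]
    simp only [Nat.cast_zero, mul_zero, zero_div, Real.sin_zero, Complex.ofReal_zero, zero_mul,
      zero_sub, norm_neg, norm_mul, norm_pow, Complex.norm_exp_ofReal_mul_I, one_pow, one_mul,
      mul_one, Complex.norm_real, Real.norm_eq_abs]
    rw [abs_of_nonneg (Real.sqrt_nonneg _)]
    gcongr
    exact Real.abs_sin_le_abs.trans_eq (abs_of_nonneg (by positivity))
  · have hval : 1 ≤ k.val := Nat.one_le_iff_ne_zero.mpr (by simpa using hk)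
    have h₁ : (k - 1).val + 1 = k.val := by
      rw [ZMod.val_sub (by rwa [ZMod.val_one]), ZMod.val_one]
      lia
    have h₂ : (k.val : ℝ) = (k - 1).val + 1 := by exact_mod_cast h₁.symm
    have h₃ : (sineWindow N k * Complex.exp (φ * Complex.I) ^ k.val -
        Complex.exp (φ * Complex.I) *
          (sineWindow N (k - 1) * Complex.exp (φ * Complex.I) ^ (k - 1).val) : ℂ) =
        ((sineWindow N k - sineWindow N (k - 1) : ℝ) : ℂ) *
          Complex.exp (φ * Complex.I) ^ k.val := by
      rw [← h₁, pow_succ]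
      push_cast
      ring
    rw [h₃, norm_mul, norm_pow, Complex.norm_exp_ofReal_mul_I, one_pow, mul_one,
      Complex.norm_real, Real.norm_eq_abs, sineWindow, sineWindow, ← mul_sub, abs_mul,
      abs_of_nonneg (Real.sqrt_nonneg _)]
    gcongr
    refine (Real.abs_sin_sub_sin_le _ _).trans_eq ?_
    rw [h₂, ← sub_div, ← mul_sub, add_sub_cancel_left, mul_one, abs_of_nonneg (by positivity)]

/-- The mean squared chordal distance between the estimated and the true eigenvalue. -/
theorem sum_windowProb_mul_dist_sq_le (hN : 2 ≤ N) (φ : ℝ) :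
    ∑ y, windowProb N φ y * ‖ZMod.stdAddChar y - Complex.exp (φ * Complex.I)‖ ^ 2 ≤
      20 / (N : ℝ) ^ 2 := by
  have hN₀ : (0 : ℝ) < N := by positivity
  set z := Complex.exp (φ * Complex.I) with hz
  set u : ZMod N → ℂ := fun k => sineWindow N k * z ^ k.val with hu
  -- A cyclic shift multiplies the Fourier coefficient at `y` by a character value. Hence weighting
  -- by the distance to `z` amounts to transforming `u k - z * u (k - 1)`, whose norm Parseval
  -- controls.
  have hshift (y : ZMod N) : (dftGate N *ᵥ fun k => u (k - 1)) y =
      ZMod.stdAddChar (-y) * (dftGate N *ᵥ u) y := by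
    simp only [mulVec, dotProduct]
    rw [← Equiv.sum_comp (Equiv.addRight (1 : ZMod N)), Finset.mul_sum]
    refine Finset.sum_congr rfl fun k _ => ?_
    simp only [Equiv.coe_addRight, add_sub_cancel_right, dftGate, of_apply, mul_add, mul_one,
      neg_add, AddChar.map_add_eq_mul]
    ring
  have hnorm (y : ZMod N) : windowProb N φ y * ‖ZMod.stdAddChar y - z‖ ^ 2 =
      ‖(dftGate N *ᵥ fun k => u k - z * u (k - 1)) y‖ ^ 2 := by
    have h₁ : (fun k => u k - z * u (k - 1)) = u - z • fun k => u (k - 1) := rfl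
    have h₂ : (dftGate N *ᵥ fun k => u k - z * u (k - 1)) y =
        ZMod.stdAddChar (-y) * ((dftGate N *ᵥ u) y * (ZMod.stdAddChar y - z)) := by
      have h₃ : (ZMod.stdAddChar (-y) : ℂ) * ZMod.stdAddChar y = 1 := by
        rw [← AddChar.map_add_eq_mul, neg_add_cancel, AddChar.map_zero_eq_one]
      rw [h₁, mulVec_sub, mulVec_smul, Pi.sub_apply, Pi.smul_apply, hshift, smul_eq_mul]
      linear_combination (-(dftGate N *ᵥ u) y) * h₃
    rw [h₂, norm_mul, AddChar.norm_apply, one_mul, norm_mul, mul_pow]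
    rfl
  simp only [hnorm]
  rw [sum_norm_sq_mulVec dftGate_mem_unitary]
  calc ∑ k, ‖u k - z * u (k - 1)‖ ^ 2 ≤ ∑ _k : ZMod N, (√(2 / N) * (Real.pi / N)) ^ 2 := by
        gcongr with k
        exact norm_windowed_sub_le hN φ k
    _ = 2 * Real.pi ^ 2 / (N : ℝ) ^ 2 := by
        rw [Finset.sum_const, Finset.card_univ, ZMod.card, nsmul_eq_mul, mul_pow,
          Real.sq_sqrt (by positivity)]
        field_simp
    _ ≤ 20 / (N : ℝ) ^ 2 := by
        gcongr
        nlinarith [Real.pi_lt_d2, Real.pi_pos]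

/-- The counter value indicates an amplitude of at least `s`. -/
def Indicates (N : ℕ) [NeZero N] (s : ℝ) (y : ZMod N) : Prop := 2 * s ≤ ‖1 - ZMod.stdAddChar y‖

noncomputable instance (s : ℝ) : DecidablePred (Indicates N s) := fun _ => Classical.dec _

/-- Chebyshev's inequality for the chordal distance; the constant is `20 / 2 ^ 2`. -/
theorem sum_windowProb_le_of_dist (hN : 2 ≤ N) {φ Δ : ℝ} (hΔ : 0 < Δ) (J : ZMod N → Prop)
    [DecidablePred J]
    (hJ : ∀ y, J y → 2 * Δ ≤ ‖ZMod.stdAddChar y - Complex.exp (φ * Complex.I)‖) :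
    ∑ y with J y, windowProb N φ y ≤ 5 / (N * Δ) ^ 2 := by
  have hN₀ : (0 : ℝ) < N := by positivity
  have h : (2 * Δ) ^ 2 * ∑ y with J y, windowProb N φ y ≤ 20 / (N : ℝ) ^ 2 := by
    refine le_trans ?_ (sum_windowProb_mul_dist_sq_le hN φ)
    rw [Finset.mul_sum]
    refine (Finset.sum_le_sum fun y hy => ?_).trans
      (Finset.sum_le_sum_of_subset_of_nonneg (Finset.filter_subset J _)
        fun y _ _ => mul_nonneg (windowProb_nonneg φ y) (by positivity))
    rw [mul_comm]
    gcongr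
    · exact windowProb_nonneg φ y
    · exact hJ y (Finset.mem_filter.mp hy).2
  rw [mul_pow, le_div_iff₀ (by positivity)]
  rw [le_div_iff₀ (by positivity)] at h
  linarith

/-- The chord from `1` to the eigenvalue is twice the amplitude, so amplitude thresholds are chord
thresholds and the triangle inequality replaces estimates of angles. -/
theorem norm_one_sub_exp {φ p : ℝ} (hφ : Real.cos φ = 1 - 2 * p) :
    ‖1 - Complex.exp (φ * Complex.I)‖ = 2 * √p := by
  have h : ‖1 - Complex.exp (φ * Complex.I)‖ ^ 2 = 4 * p := by
    rw [← Complex.normSq_eq_norm_sq, Complex.normSq_apply]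
    simp only [Complex.sub_re, Complex.sub_im, Complex.one_re, Complex.one_im,
      Complex.exp_ofReal_mul_I_re, Complex.exp_ofReal_mul_I_im]
    nlinarith [Real.sin_sq_add_cos_sq φ]
  rw [← Real.sqrt_sq (norm_nonneg _), h, Real.sqrt_mul (by norm_num),
    show (4 : ℝ) = 2 ^ 2 by norm_num, Real.sqrt_sq (by norm_num)]

theorem sum_windowProb_indicates_le (hN : 2 ≤ N) {φ p s Δ : ℝ} (hΔ : 0 < Δ)
    (hφ : Real.cos φ = 1 - 2 * p) (hp : √p ≤ s - Δ) :
    ∑ y with Indicates N s y, windowProb N φ y ≤ 5 / (N * Δ) ^ 2 := by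
  refine sum_windowProb_le_of_dist hN hΔ _ fun y hy => ?_
  have h₁ := norm_one_sub_exp hφ
  have h₂ := norm_sub_norm_le (1 - ZMod.stdAddChar y) (1 - Complex.exp (φ * Complex.I))
  rw [sub_sub_sub_cancel_left, norm_sub_rev (Complex.exp _)] at h₂
  rw [Indicates] at hy
  linarith

theorem sum_windowProb_not_indicates_le (hN : 2 ≤ N) {φ p s Δ : ℝ} (hΔ : 0 < Δ)
    (hφ : Real.cos φ = 1 - 2 * p) (hp : s + Δ ≤ √p) :
    ∑ y with ¬ Indicates N s y, windowProb N φ y ≤ 5 / (N * Δ) ^ 2 := by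
  refine sum_windowProb_le_of_dist hN hΔ _ fun y hy => ?_
  have h₁ := norm_one_sub_exp hφ
  have h₂ := norm_sub_norm_le (1 - Complex.exp (φ * Complex.I)) (1 - ZMod.stdAddChar y)
  rw [sub_sub_sub_cancel_left] at h₂
  rw [Indicates] at hy
  linarith

end PhaseEstimation

/-! ### Independent repetitions of phase estimation -/

section Repetition

variable {K : Type*} [Fintype K] [DecidableEq K] {r : ℕ}

/-- The gate `F` applied to each of `r` registers. -/
def powerGate (r : ℕ) (F : Matrix K K ℂ) : Matrix (Fin r → K) (Fin r → K) ℂ :=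
  Matrix.of fun y k => ∏ i, F (y i) (k i)

theorem powerGate_mem_unitary {F : Matrix K K ℂ} (hF : F ∈ unitaryGroup K ℂ) :
    powerGate r F ∈ unitaryGroup (Fin r → K) ℂ := by
  apply mem_unitary_of_conjTranspose_mul_self
  ext k l
  have h (i : Fin r) : ∑ y, star (F y (k i)) * F y (l i) = if k i = l i then 1 else 0 := by
    rw [← Matrix.one_apply, ← conjTranspose_mul_self_of_mem_unitary hF]
    rfl
  simp only [Matrix.mul_apply, conjTranspose_apply, powerGate, of_apply, star_prod,
    ← Finset.prod_mul_distrib]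
  rw [← Fintype.prod_sum (fun i y => star (F y (k i)) * F y (l i))]
  simp only [h, Matrix.one_apply, funext_iff]
  rw [Finset.prod_ite_zero]
  simp

/-- The phase raised to a sum of exponents factors, so for a fixed eigenphase the counters are
independent. The `r` runs can therefore share a single register `X`. -/
theorem phaseProb_powerGate (F : Matrix K K ℂ) (c : K → ℂ) (m : K → ℕ) (φ : ℝ) (y : Fin r → K) :
    phaseProb (powerGate r F) (fun k => ∏ i, c (k i)) (fun k => ∑ i, m (k i)) φ y =
      ∏ i, phaseProb F c m φ (y i) := by
  simp only [phaseProb, mulVec, dotProduct, powerGate, of_apply]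
  rw [Finset.prod_pow, ← norm_prod, Fintype.prod_sum]
  simp only [← Finset.prod_pow_eq_pow_sum, ← Finset.prod_mul_distrib]

/-- If each of `r` independent trials is bad with probability at most `1/16`, then at least half
of them are bad with probability at most `2⁻ʳ`. -/
theorem sum_prod_majority_le {d : K → ℝ} (hd : ∀ y, 0 ≤ d y) (hsum : ∑ y, d y = 1)
    (J : K → Prop) [DecidablePred J] (hJ : ∑ y with J y, d y ≤ 1 / 16) :
    ∑ y : Fin r → K with r ≤ 2 * (Finset.univ.filter fun i => J (y i)).card, ∏ i, d (y i) ≤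
      (1 / 2) ^ r := by
  -- Exponential Markov bound: a bad trial has weight `4` and a good one `1/4`. The mean weight is
  -- at most `15/64 + 1/4 < 1/2`.
  have hweight (y : Fin r → K) (hy : r ≤ 2 * (Finset.univ.filter fun i => J (y i)).card) :
      (1 : ℝ) ≤ ∏ i, if J (y i) then 4 else 1 / 4 := by
    have hcard := Finset.card_filter_add_card_filter_not (s := Finset.univ) fun i => J (y i)
    rw [Finset.card_univ, Fintype.card_fin] at hcard
    rw [Finset.prod_ite, Finset.prod_const, Finset.prod_const, one_div, inv_pow,
      ← div_eq_mul_inv, one_le_div (by positivity)]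
    exact pow_le_pow_right₀ (by norm_num) (by lia)
  have hfactor : ∑ y, (if J y then 4 else 1 / 4) * d y ≤ 1 / 2 := by
    have h : ∑ y, (if J y then 4 else 1 / 4) * d y =
        (15 / 4) * ∑ y with J y, d y + (1 / 4) * ∑ y, d y := by
      rw [Finset.sum_filter, Finset.mul_sum, Finset.mul_sum, ← Finset.sum_add_distrib]
      refine Finset.sum_congr rfl fun y _ => ?_
      split_ifs <;> ring
    rw [h, hsum]
    linarith
  calc ∑ y : Fin r → K with r ≤ 2 * (Finset.univ.filter fun i => J (y i)).card, ∏ i, d (y i)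
      ≤ ∑ y : Fin r → K with r ≤ 2 * (Finset.univ.filter fun i => J (y i)).card,
          ∏ i, (if J (y i) then 4 else 1 / 4) * d (y i) := by
        refine Finset.sum_le_sum fun y hy => ?_
        rw [Finset.prod_mul_distrib]
        exact le_mul_of_one_le_left (Finset.prod_nonneg fun i _ => hd _)
          (hweight y (Finset.mem_filter.mp hy).2)
    _ ≤ ∑ y : Fin r → K, ∏ i, (if J (y i) then 4 else 1 / 4) * d (y i) :=
        Finset.sum_le_sum_of_subset_of_nonneg (Finset.filter_subset _ _) fun y _ _ =>
          Finset.prod_nonneg fun i _ => mul_nonneg (by split_ifs <;> norm_num) (hd _)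
    _ = (∑ y, (if J y then 4 else 1 / 4) * d y) ^ r := 
        (Fintype.sum_pow (fun y => (if J y then (4 : ℝ) else 1 / 4) * d y) r).symm
    _ ≤ (1 / 2) ^ r := by
        gcongr
        exact Finset.sum_nonneg fun y _ => mul_nonneg (by split_ifs <;> norm_num) (hd _)

end Repetition

/-! ### Threshold tests for an amplitude -/

section Thresholds

variable {X K : Type*} [Fintype X] [DecidableEq X] [Fintype K] [DecidableEq K]

theorem amplitudeTest_mem_unitary {F C : Matrix K K ℂ} (hF : F ∈ unitaryGroup K ℂ)
    (hC : C ∈ unitaryGroup K ℂ) (m : K → ℕ) {V : Matrix X X ℂ} (hV : V ∈ unitaryGroup X ℂ)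
    (P : X → Prop) [DecidablePred P] (x₀ : X) :
    amplitudeTest F C m V P x₀ ∈ unitaryGroup (X × K) ℂ :=
  mul_mem (mul_mem (kronecker_mem_unitary (one_mem (unitaryGroup X ℂ)) hF)
    (blockDiagonal_mem_unitary fun k => pow_mem (grover_mem_unitary hV P x₀) (m k)))
    (kronecker_mem_unitary (one_mem (unitaryGroup X ℂ)) hC)

/-- Both `θ = arccos (1 - 2p)` and `-θ` satisfy the condition on `φ`, so a bound uniform in `φ`
survives averaging. -/
theorem hitProb_amplitudeTest_le {F C : Matrix K K ℂ} {m : K → ℕ} {V : Matrix X X ℂ}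
    (hV : V ∈ unitaryGroup X ℂ) (P : X → Prop) [DecidablePred P] (x₀ : X) (k₀ : K)
    (J : K → Prop) [DecidablePred J] {b : ℝ}
    (h : ∀ φ, Real.cos φ = 1 - 2 * hitProb V P x₀ →
      ∑ y with J y, phaseProb F (C · k₀) m φ y ≤ b) :
    hitProb (amplitudeTest F C m V P x₀) (fun z => J z.2) (x₀, k₀) ≤ b := by
  have h₀ := hitProb_nonneg V P x₀
  have h₁ := hitProb_le_one hV P x₀
  have hθ : Real.cos (Real.arccos (1 - 2 * hitProb V P x₀)) = 1 - 2 * hitProb V P x₀ :=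
    Real.cos_arccos (by linarith) (by linarith)
  have hsum : hitProb (amplitudeTest F C m V P x₀) (fun z => J z.2) (x₀, k₀) =
      ∑ y with J y, ∑ x, ‖amplitudeTest F C m V P x₀ (x, y) (x₀, k₀)‖ ^ 2 := by
    rw [hitProb, Finset.sum_filter, Fintype.sum_prod_type_right, Finset.sum_filter]
    refine Finset.sum_congr rfl fun y _ => ?_
    split_ifs <;> simp
  rw [hsum]
  simp only [sum_norm_sq_amplitudeTest F C m hV P x₀ hθ]
  rw [← Finset.sum_div, Finset.sum_add_distrib]
  have h₂ := h _ hθ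
  have h₃ := h _ ((Real.cos_neg _).trans hθ)
  linarith

variable {N : ℕ} [NeZero N] {V : Matrix X X ℂ} {P : X → Prop} [DecidablePred P] {x₀ : X}
  {s Δ : ℝ}

theorem hitProb_windowTest_le (hN : 2 ≤ N) (hV : V ∈ unitaryGroup X ℂ)
    {C : Matrix (ZMod N) (ZMod N) ℂ} (hC : ∀ k, C k 0 = sineWindow N k) (hΔ : 0 < Δ)
    (hp : √(hitProb V P x₀) ≤ s - Δ) :
    hitProb (amplitudeTest (dftGate N) C ZMod.val V P x₀) (fun z => Indicates N s z.2) (x₀, 0) ≤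
      5 / (N * Δ) ^ 2 :=
  hitProb_amplitudeTest_le hV P x₀ 0 _ fun φ hφ => by
    simp only [hC]
    exact sum_windowProb_indicates_le hN hΔ hφ hp

theorem hitProb_windowTest_ge (hN : 2 ≤ N) (hV : V ∈ unitaryGroup X ℂ)
    {C : Matrix (ZMod N) (ZMod N) ℂ} (hCu : C ∈ unitaryGroup (ZMod N) ℂ)
    (hC : ∀ k, C k 0 = sineWindow N k) (hΔ : 0 < Δ) (hp : s + Δ ≤ √(hitProb V P x₀)) :
    1 - 5 / (N * Δ) ^ 2 ≤
      hitProb (amplitudeTest (dftGate N) C ZMod.val V P x₀) (fun z => Indicates N s z.2)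
        (x₀, 0) := by
  have h₁ := hitProb_add_not (amplitudeTest_mem_unitary dftGate_mem_unitary hCu ZMod.val hV P x₀)
    (fun z => Indicates N s z.2) (x₀, 0)
  have h₂ : hitProb (amplitudeTest (dftGate N) C ZMod.val V P x₀)
      (fun z => ¬ Indicates N s z.2) (x₀, 0) ≤ 5 / (N * Δ) ^ 2 :=
    hitProb_amplitudeTest_le hV P x₀ 0 (fun y => ¬ Indicates N s y) fun φ hφ => by
      simp only [hC]
      exact sum_windowProb_not_indicates_le hN hΔ hφ hp
  linarith

/-- At least half of the `r` counters indicate an amplitude of at least `s`. -/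
def MajorityIndicates (N : ℕ) [NeZero N] (s : ℝ) {r : ℕ} (y : Fin r → ZMod N) : Prop :=
  r ≤ 2 * (Finset.univ.filter fun i => Indicates N s (y i)).card

noncomputable instance (s : ℝ) {r : ℕ} : DecidablePred (MajorityIndicates N s (r := r)) :=
  fun _ => Classical.dec _

variable {r : ℕ}

theorem phaseProb_powerGate_window (φ : ℝ) (y : Fin r → ZMod N) :
    phaseProb (powerGate r (dftGate N)) (fun k => ∏ i, (sineWindow N (k i) : ℂ))
      (fun k => ∑ i, (k i).val) φ y = ∏ i, windowProb N φ (y i) :=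
  phaseProb_powerGate (dftGate N) (fun k => (sineWindow N k : ℂ)) ZMod.val φ y

theorem hitProb_majorityTest_le (hN : 2 ≤ N) (hV : V ∈ unitaryGroup X ℂ)
    {C : Matrix (Fin r → ZMod N) (Fin r → ZMod N) ℂ}
    (hC : ∀ k, C k 0 = ∏ i, (sineWindow N (k i) : ℂ)) (hΔ : 0 < Δ)
    (herr : 5 / (N * Δ) ^ 2 ≤ 1 / 16) (hp : √(hitProb V P x₀) ≤ s - Δ) :
    hitProb (amplitudeTest (powerGate r (dftGate N)) C (fun k => ∑ i, (k i).val) V P x₀)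
      (fun z => MajorityIndicates N s z.2) (x₀, 0) ≤ (1 / 2) ^ r :=
  hitProb_amplitudeTest_le hV P x₀ 0 _ fun φ hφ => by
    simp only [hC, phaseProb_powerGate_window]
    convert sum_prod_majority_le (r := r) (windowProb_nonneg φ) (sum_windowProb hN φ)
      (Indicates N s) ((sum_windowProb_indicates_le hN hΔ hφ hp).trans herr) using 2
    ext y
    rw [Finset.mem_filter, Finset.mem_filter]
    rfl

theorem hitProb_not_majorityTest_le (hN : 2 ≤ N) (hV : V ∈ unitaryGroup X ℂ)
    {C : Matrix (Fin r → ZMod N) (Fin r → ZMod N) ℂ}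
    (hC : ∀ k, C k 0 = ∏ i, (sineWindow N (k i) : ℂ)) (hΔ : 0 < Δ)
    (herr : 5 / (N * Δ) ^ 2 ≤ 1 / 16) (hp : s + Δ ≤ √(hitProb V P x₀)) :
    hitProb (amplitudeTest (powerGate r (dftGate N)) C (fun k => ∑ i, (k i).val) V P x₀)
      (fun z => ¬ MajorityIndicates N s z.2) (x₀, 0) ≤ (1 / 2) ^ r :=
  hitProb_amplitudeTest_le hV P x₀ 0 (fun y => ¬ MajorityIndicates N s y) fun φ hφ => by
    simp only [hC, phaseProb_powerGate_window]
    refine le_trans (Finset.sum_le_sum_of_subset_of_nonneg ?_ fun y _ _ =>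
      Finset.prod_nonneg fun i _ => windowProb_nonneg φ (y i))
      (sum_prod_majority_le (r := r) (windowProb_nonneg φ) (sum_windowProb hN φ)
        (fun y => ¬ Indicates N s y)
        ((sum_windowProb_not_indicates_le hN hΔ hφ hp).trans herr))
    intro y hy
    rw [Finset.mem_filter] at hy ⊢
    have hlt : ¬ r ≤ 2 * (Finset.univ.filter fun i => Indicates N s (y i)).card := hy.2
    refine ⟨Finset.mem_univ _, ?_⟩
    have hcard := Finset.card_filter_add_card_filter_not (s := Finset.univ)
      fun i => Indicates N s (y i)
    rw [Finset.card_univ, Fintype.card_fin] at hcard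
    lia

end Thresholds

/-! ### Testing the probability of a sampled outcome -/

section Sampling

variable {n a : ℕ}

/-- The initial label of the oracle register. -/
abbrev zeroReg (n a : ℕ) : OracleReg n a := (zeros n, zeros a)

theorem hitProb_oracle (O : Oracle n a) (x : Bits n) :
    hitProb (O : Matrix (OracleReg n a) (OracleReg n a) ℂ) (fun y => y.1 = x) (zeroReg n a) =
      outcomeProb O x := by
  rw [hitProb, outcomeProb, Finset.sum_filter, Fintype.sum_prod_type, Finset.sum_eq_single x]
  · simp
  · intro y _ hy
    simp [hy]
  · simp

variable {N : ℕ} [NeZero N]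

/-- Sample with the oracle, move the sample to a separate register, and test with a counter in
`ZMod N` the amplitude of the sampled outcome. -/
noncomputable def sampleTest (C : Matrix (ZMod N) (ZMod N) ℂ) (O : Oracle n a) :
    Matrix ((OracleReg n a × ZMod N) × OracleReg n a)
      ((OracleReg n a × ZMod N) × OracleReg n a) ℂ :=
  (blockDiagonal fun s : OracleReg n a =>
      amplitudeTest (dftGate N) C ZMod.val (O : Matrix (OracleReg n a) (OracleReg n a) ℂ)
        (fun y => y.1 = s.1) (zeroReg n a)) *
    (permGate (Function.Involutive.toPerm (fun z => ((z.2, z.1.2), z.1.1)) fun _ => rfl) *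
      blockDiagonal fun _ => blockDiagonal fun _ =>
        (O : Matrix (OracleReg n a) (OracleReg n a) ℂ))

theorem sampleTest_apply (C : Matrix (ZMod N) (ZMod N) ℂ) (O : Oracle n a)
    (z : OracleReg n a × ZMod N) (s : OracleReg n a) :
    sampleTest C O (z, s) ((zeroReg n a, 0), zeroReg n a) =
      amplitudeTest (dftGate N) C ZMod.val (O : Matrix (OracleReg n a) (OracleReg n a) ℂ)
        (fun y => y.1 = s.1) (zeroReg n a) z (zeroReg n a, 0) *
      (O : Matrix (OracleReg n a) (OracleReg n a) ℂ) s (zeroReg n a) := by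
  rw [sampleTest, Matrix.mul_apply, Finset.sum_eq_single ((zeroReg n a, 0), s)]
  · rw [permGate_mul_apply, blockDiagonal_apply_eq]
    change _ * blockDiagonal _ ((s, 0), zeroReg n a) _ = _
    rw [blockDiagonal_apply_eq, blockDiagonal_apply_eq]
  · rintro ⟨⟨y, k⟩, t⟩ _ hne
    rw [permGate_mul_apply]
    change _ * blockDiagonal _ ((t, k), y) _ = _
    simp only [blockDiagonal_apply]
    by_cases hst : s = t <;> by_cases hk : k = 0 <;> by_cases hy : y = zeroReg n a <;>
      simp_all
  · simp

/-- The stored sample only controls the test, so different samples do not interfere and the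
probabilities average classically. -/
theorem hitProb_sampleTest (C : Matrix (ZMod N) (ZMod N) ℂ) (O : Oracle n a)
    (J : ZMod N → Prop) [DecidablePred J] :
    hitProb (sampleTest C O) (fun z => J z.1.2) ((zeroReg n a, 0), zeroReg n a) =
      ∑ s, hitProb (amplitudeTest (dftGate N) C ZMod.val
          (O : Matrix (OracleReg n a) (OracleReg n a) ℂ) (fun y => y.1 = s.1) (zeroReg n a))
          (fun z => J z.2) (zeroReg n a, 0) *
        ‖(O : Matrix (OracleReg n a) (OracleReg n a) ℂ) s (zeroReg n a)‖ ^ 2 := by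
  rw [hitProb, Finset.sum_filter, Fintype.sum_prod_type_right]
  refine Finset.sum_congr rfl fun s _ => ?_
  rw [hitProb, Finset.sum_filter, Finset.sum_mul]
  refine Finset.sum_congr rfl fun z _ => ?_
  rw [sampleTest_apply, norm_mul, mul_pow, ite_mul, zero_mul]

theorem implements_sampleTest {C : Matrix (ZMod N) (ZMod N) ℂ}
    (hC : C ∈ unitaryGroup (ZMod N) ℂ) :
    Implements (fun O : Oracle n a => blockDiagonal fun _ : OracleReg n a =>
        blockDiagonal fun _ : ZMod N => (O : Matrix (OracleReg n a) (OracleReg n a) ℂ))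
      (testQueries [.forward] N ++ [.forward]) (sampleTest C) := by
  have h (s : OracleReg n a) := (Implements.query fun O : Oracle n a =>
    (O : Matrix (OracleReg n a) (OracleReg n a) ℂ)).amplitudeTest (fun O => O.2)
      (dftGate_mem_unitary (N := N)) hC (m := ZMod.val) (T := N) (fun k => (ZMod.val_lt k).le)
      (fun y => y.1 = s.1) (zeroReg n a)
  exact (Implements.blockDiagonal h).mul ((Implements.query _).gate_mul (permGate_mem_unitary _))

theorem sampleTest_mem_unitary {C : Matrix (ZMod N) (ZMod N) ℂ}
    (hC : C ∈ unitaryGroup (ZMod N) ℂ) (O : Oracle n a) :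
    sampleTest C O ∈ unitaryGroup ((OracleReg n a × ZMod N) × OracleReg n a) ℂ :=
  (implements_sampleTest hC).mem_unitary (fun O => blockDiagonal_mem_unitary fun _ =>
    blockDiagonal_mem_unitary fun _ => O.2) O

variable {C : Matrix (ZMod N) (ZMod N) ℂ} {τ εr : ℝ}

/-- Since `1 - εr ≤ (1 - εr/2)²`, light outcomes have amplitude at most `(1 - εr/2) √τ`. The
threshold is halfway between this and `√τ`, with margin `εr √τ / 4` on either side. -/
theorem hitProb_sampleTest_le (hN : 2 ≤ N) (hC : ∀ k, C k 0 = sineWindow N k) (hτ : 0 < τ)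
    (hε : 0 < εr) (hε₁ : εr < 1) (herr : 5 / (N * (εr * √τ / 4)) ^ 2 ≤ τ / 8) {O : Oracle n a}
    (hO : ∀ x, outcomeProb O x < (1 - εr) * τ) :
    hitProb (sampleTest C O) (fun z => Indicates N (√τ - εr * √τ / 4) z.1.2)
      ((zeroReg n a, 0), zeroReg n a) ≤ τ / 8 := by
  have hτ' := Real.sqrt_pos.mpr hτ
  rw [hitProb_sampleTest, ← mul_one (τ / 8), ← sum_norm_sq_column O.2 (zeroReg n a),
    Finset.mul_sum]
  gcongr with s
  refine (hitProb_windowTest_le hN O.2 hC (by positivity) ?_).trans herr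
  rw [hitProb_oracle]
  calc √(outcomeProb O s.1) ≤ √((1 - εr / 2) ^ 2 * τ) := by
        refine Real.sqrt_le_sqrt ((hO s.1).le.trans ?_)
        gcongr
        nlinarith
    _ = √τ - εr * √τ / 4 - εr * √τ / 4 := by
        rw [Real.sqrt_mul (by positivity), Real.sqrt_sq (by linarith)]
        ring

/-- Only samples equal to `x` are counted: their total weight is at least `τ`, and each is flagged
with probability at least `1 - τ/8 ≥ 1/2`. -/
theorem hitProb_sampleTest_ge (hN : 2 ≤ N) (hCu : C ∈ unitaryGroup (ZMod N) ℂ)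
    (hC : ∀ k, C k 0 = sineWindow N k) (hτ : 0 < τ) (hτ₁ : τ < 1) (hε : 0 < εr)
    (herr : 5 / (N * (εr * √τ / 4)) ^ 2 ≤ τ / 8) {O : Oracle n a} {x : Bits n}
    (hx : τ ≤ outcomeProb O x) :
    τ / 2 ≤ hitProb (sampleTest C O) (fun z => Indicates N (√τ - εr * √τ / 4) z.1.2)
      ((zeroReg n a, 0), zeroReg n a) := by
  have hτ' := Real.sqrt_pos.mpr hτ
  rw [hitProb_sampleTest]
  calc τ / 2 ≤ 1 / 2 * outcomeProb O x := by linarith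
    _ = ∑ s : OracleReg n a with s.1 = x,
        1 / 2 * ‖(O : Matrix (OracleReg n a) (OracleReg n a) ℂ) s (zeroReg n a)‖ ^ 2 := by
      rw [← hitProb_oracle, hitProb, Finset.mul_sum]
    _ ≤ ∑ s : OracleReg n a with s.1 = x, hitProb (amplitudeTest (dftGate N) C ZMod.val
          (O : Matrix (OracleReg n a) (OracleReg n a) ℂ) (fun y => y.1 = s.1) (zeroReg n a))
          (fun z => Indicates N (√τ - εr * √τ / 4) z.2) (zeroReg n a, 0) *
        ‖(O : Matrix (OracleReg n a) (OracleReg n a) ℂ) s (zeroReg n a)‖ ^ 2 := by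
      gcongr with s hs
      have hs : s.1 = x := (Finset.mem_filter.mp hs).2
      refine le_trans ?_ (hitProb_windowTest_ge hN O.2 hCu hC (Δ := εr * √τ / 4) (by positivity)
        ?_)
      · linarith
      · rw [hitProb_oracle, hs, sub_add_cancel]
        exact Real.sqrt_le_sqrt hx
    _ ≤ _ := Finset.sum_le_sum_of_subset_of_nonneg (Finset.filter_subset _ _) fun s _ _ =>
      mul_nonneg (hitProb_nonneg _ _ _) (by positivity)

end Sampling

/-! ### The algorithm -/

section Main

-- The work qubits are the inner counter (`κ₁`), the stored sample (`n + a`), the `r` outer counters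
-- (`κ₂ * r`) and the output. The outer test separates `√(τ/2) / 2` from `√(τ/2)`, with threshold at
-- the midpoint.
set_option synthInstance.maxSize 2000 in
theorem exists_solvesRelHighDist {n a κ₁ κ₂ r : ℕ} {τ εr δ : ℝ} (hκ₁ : κ₁ ≠ 0) (hκ₂ : κ₂ ≠ 0)
    (hτ : 0 < τ) (hτ₁ : τ < 1) (hε : 0 < εr) (hε₁ : εr < 1)
    (herr₁ : 5 / (((2 ^ κ₁ : ℕ) : ℝ) * (εr * √τ / 4)) ^ 2 ≤ τ / 8)
    (herr₂ : 5 / (((2 ^ κ₂ : ℕ) : ℝ) * (√(τ / 2) / 4)) ^ 2 ≤ 1 / 16) (hr : (1 / 2) ^ r ≤ δ) :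
    ∃ A : QueryAlgorithm n a (κ₁ + (n + a) + κ₂ * r + 1), A.SolvesRelHighDist τ εr δ ∧
      A.queryCount = r * 2 ^ κ₂ * (2 * (2 ^ κ₁ * 2 + 1)) := by
  have hN₁ : 2 ≤ 2 ^ κ₁ := Nat.le_self_pow hκ₁ 2
  have hN₂ : 2 ≤ 2 ^ κ₂ := Nat.le_self_pow hκ₂ 2
  have : NeZero (2 ^ κ₁) := ⟨by positivity⟩
  have : NeZero (2 ^ κ₂) := ⟨by positivity⟩
  generalize hM₁ : 2 ^ κ₁ = N₁ at *
  generalize hM₂ : 2 ^ κ₂ = N₂ at *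
  have hτ' : 0 < √(τ / 2) := Real.sqrt_pos.mpr (by positivity)
  obtain ⟨C₁, hC₁u, hC₁⟩ := exists_unitary_column (fun k => (sineWindow N₁ k : ℂ))
    (by simpa using sum_sineWindow_sq hN₁) 0
  obtain ⟨C₂, hC₂u, hC₂⟩ := exists_unitary_column
    (fun k : Fin r → ZMod N₂ => ∏ i, (sineWindow N₂ (k i) : ℂ)) (by
      simp only [norm_prod, ← Finset.prod_pow]
      rw [← Fintype.sum_pow (fun k => ‖(sineWindow N₂ k : ℂ)‖ ^ 2) r]
      simp [sum_sineWindow_sq hN₂]) 0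
  let V := fun O : Oracle n a => amplitudeTest (powerGate r (dftGate N₂)) C₂
    (fun k => ∑ i, (k i).val) (sampleTest C₁ O)
    (fun z => Indicates N₁ (√τ - εr * √τ / 4) z.1.2) ((zeroReg n a, 0), zeroReg n a)
  have hVu (O : Oracle n a) : V O ∈ unitaryGroup _ ℂ :=
    amplitudeTest_mem_unitary (powerGate_mem_unitary dftGate_mem_unitary) hC₂u _
      (sampleTest_mem_unitary hC₁u O) _ _
  have hV := (implements_sampleTest hC₁u).amplitudeTest (A := sampleTest (n := n) (a := a) C₁)
    (sampleTest_mem_unitary hC₁u) (powerGate_mem_unitary (r := r) (dftGate_mem_unitary (N := N₂)))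
    hC₂u (m := fun k => ∑ i, (k i).val) (T := r * N₂) (fun k => by
      refine (Finset.sum_le_sum fun i _ => (ZMod.val_lt (k i)).le).trans ?_
      simp)
    (fun z => Indicates N₁ (√τ - εr * √τ / 4) z.1.2) ((zeroReg n a, 0), zeroReg n a)
  -- Everything except the active oracle register is gathered into one work register.
  let e : OracleReg n a × ((ZMod N₁ × OracleReg n a) × (Fin r → ZMod N₂)) ≃
      ((OracleReg n a × ZMod N₁) × OracleReg n a) × (Fin r → ZMod N₂) :=
    { toFun z := (((z.1, z.2.1.1), z.2.1.2), z.2.2)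
      invFun z := (z.1.1.1, ((z.1.1.2, z.1.2), z.2))
      left_inv _ := rfl
      right_inv _ := rfl }
  have hVe := hV.submatrix e
  have hq : (fun O : Oracle n a => (blockDiagonal fun _ : Fin r → ZMod N₂ =>
      blockDiagonal fun _ : OracleReg n a => blockDiagonal fun _ : ZMod N₁ =>
        (O : Matrix (OracleReg n a) (OracleReg n a) ℂ)).submatrix e e) =
      fun O : Oracle n a => blockDiagonal fun _ =>
        (O : Matrix (OracleReg n a) (OracleReg n a) ℂ) := by
    ext O ⟨x, ⟨k, s⟩, l⟩ ⟨x', ⟨k', s'⟩, l'⟩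
    simp only [submatrix_apply, e, Equiv.coe_fn_mk, blockDiagonal_apply, Prod.mk.injEq]
    by_cases h₁ : k = k' <;> by_cases h₂ : s = s' <;> by_cases h₃ : l = l' <;>
      simp [h₁, h₂, h₃]
  rw [hq] at hVe
  obtain ⟨A, hcount, hA⟩ := hVe.exists_algorithm_of_card (w := κ₁ + (n + a) + κ₂ * r)
    (by
      simp only [Fintype.card_prod, Fintype.card_pi, ZMod.card, Fintype.card_bool,
        Finset.prod_const, Finset.card_univ, Fintype.card_fin, ← hM₁, ← hM₂]
      ring) ((0, zeroReg n a), 0)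
    (fun z => MajorityIndicates N₂ (3 / 4 * √(τ / 2)) z.2.2)
  have hprob (O : Oracle n a) (b : Bool) : A.outputProb O b =
      hitProb (V O) (fun z => decide (MajorityIndicates N₂ (3 / 4 * √(τ / 2)) z.2) = b)
        (((zeroReg n a, 0), zeroReg n a), 0) := by
    rw [hA, hitProb, Finset.sum_filter, Finset.sum_filter, ← Equiv.sum_comp e]
    rfl
  have htrue (O : Oracle n a) : A.outputProb O true =
      hitProb (V O) (fun z => MajorityIndicates N₂ (3 / 4 * √(τ / 2)) z.2)
        (((zeroReg n a, 0), zeroReg n a), 0) := by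
    simp [hprob, hitProb]
  have hfalse (O : Oracle n a) : A.outputProb O false =
      hitProb (V O) (fun z => ¬ MajorityIndicates N₂ (3 / 4 * √(τ / 2)) z.2)
        (((zeroReg n a, 0), zeroReg n a), 0) := by
    simp [hprob, hitProb]
  have hadd (O : Oracle n a) : A.outputProb O true + A.outputProb O false = 1 := by
    rw [htrue, hfalse, hitProb_add_not (hVu O)]
  refine ⟨A, fun O => ⟨fun hO => ?_, fun ⟨x, hx⟩ => ?_⟩, ?_⟩
  · have h₁ := hitProb_sampleTest_le hN₁ hC₁ hτ hε hε₁ herr₁ hO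
    have h₂ := hitProb_majorityTest_le (s := 3 / 4 * √(τ / 2)) (Δ := √(τ / 2) / 4) hN₂
      (sampleTest_mem_unitary hC₁u O) hC₂ (by positivity) herr₂
      ((Real.sqrt_le_sqrt h₁).trans_eq (by
        rw [show τ / 8 = (1 / 2) ^ 2 * (τ / 2) by ring, Real.sqrt_mul (by positivity),
          Real.sqrt_sq (by norm_num)]
        ring))
    rw [← htrue] at h₂
    linarith [hadd O]
  · have h₁ := hitProb_sampleTest_ge hN₁ hC₁u hC₁ hτ hτ₁ hε herr₁ hx
    have h₂ := hitProb_not_majorityTest_le (s := 3 / 4 * √(τ / 2)) (Δ := √(τ / 2) / 4) hN₂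
      (sampleTest_mem_unitary hC₁u O) hC₂ (by positivity) herr₂
      (le_trans (by linarith) (Real.sqrt_le_sqrt h₁))
    rw [← hfalse] at h₂
    linarith [hadd O]
  · rw [hcount, length_testQueries, List.length_append, length_testQueries]
    simp

theorem exists_pow_two_near {B : ℝ} (hB : 1 ≤ B) :
    ∃ κ : ℕ, κ ≠ 0 ∧ B ≤ ((2 ^ κ : ℕ) : ℝ) ∧ ((2 ^ κ : ℕ) : ℝ) ≤ 2 * B := by
  -- Rounding up to `k + 1` also makes the exponent nonzero, so that the counter has at least two
  -- values.
  obtain ⟨k, h₁, h₂⟩ := exists_nat_pow_near hB one_lt_two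
  refine ⟨k + 1, k.succ_ne_zero, ?_, ?_⟩
  · push_cast
    exact h₂.le
  · push_cast
    rw [pow_succ']
    linarith

theorem le_logb_two_of_pow_le {κ : ℕ} {b y : ℝ} (hy : 0 < y)
    (h : ((2 ^ κ : ℕ) : ℝ) ≤ 2 ^ b * y) : (κ : ℝ) ≤ b + Real.logb 2 y := by
  have h' : (2 : ℝ) ^ (κ : ℝ) ≤ 2 ^ b * y := by
    rw [Real.rpow_natCast]
    exact_mod_cast h
  rw [← Real.le_logb_iff_rpow_le one_lt_two (by positivity)] at h'
  rwa [Real.logb_mul (by positivity) hy.ne', Real.logb_rpow (by norm_num) (by norm_num)] at h'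

end Main

end HighDist

/-! ### Choice of the parameters and count of the resources -/

theorem mainTheorem8 :
    ∃ C : ℝ, 0 < C ∧
      ∀ (m n a : ℕ) (τ εr δ : ℝ), m = 2 ^ n → 0 < n + a →
        0 < τ → τ < 1 → 0 < εr → εr < 1 → 0 < δ → δ < 1 / 2 →
        ∃ (w : ℕ) (A : HighDist.QueryAlgorithm n a w),
          A.SolvesRelHighDist τ εr δ ∧
          (A.queryCount : ℝ) ≤
            C * (1 / (εr * τ ^ (3 / 2 : ℝ)) * Real.logb 2 (1 / (δ * τ))) ∧
          (A.qubitCount : ℝ) ≤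
            C * ((Real.logb 2 m + Real.logb 2 (1 / (εr * τ)) + a) *
              Real.logb 2 (1 / (δ * τ))) := by
  -- The query count dictates the constant: `2 * (2 * 52) * (6 * (2 * 26))`. The qubit count needs
  -- far less.
  refine ⟨64896, by norm_num, ?_⟩
  intro m n a τ εr δ hm hna hτ hτ₁ hε hε₁ hδ hδ₁
  have hs : 0 < √τ := Real.sqrt_pos.mpr hτ
  have hss : √τ * √τ = τ := Real.mul_self_sqrt hτ.le
  have hs₁ : √τ < 1 := by rw [Real.sqrt_lt' one_pos]; simpa using hτ₁
  have hετ : εr * τ < 1 := by nlinarith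
  have hετ₀ : 0 < εr * τ := by positivity
  -- The error conditions require `(N₁ εr τ)² ≥ 640` and `(N₂ √τ)² ≥ 2560`; `26` and `52` are the
  -- least integers that ensure this.
  have hB₁ : 1 ≤ 26 / (εr * τ) := by
    rw [le_div_iff₀ hετ₀]
    linarith
  have hB₂ : 1 ≤ 52 / √τ := by
    rw [le_div_iff₀ hs]
    linarith
  obtain ⟨κ₁, hκ₁, hlo₁, hhi₁⟩ := HighDist.exists_pow_two_near hB₁
  obtain ⟨κ₂, hκ₂, hlo₂, hhi₂⟩ := HighDist.exists_pow_two_near hB₂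
  set Λ := Real.logb 2 (1 / (δ * τ)) with hΛ
  set E := Real.logb 2 (1 / (εr * τ)) with hE
  have hΛ₁ : 1 ≤ Λ := by
    rw [hΛ, Real.le_logb_iff_rpow_le one_lt_two (by positivity), Real.rpow_one,
      le_div_iff₀ (by positivity)]
    nlinarith
  have hδΛ : Real.logb 2 (1 / δ) ≤ Λ := by
    refine Real.logb_le_logb_of_le one_lt_two (by positivity) ?_
    gcongr
    nlinarith
  have hδ₀ : 0 ≤ Real.logb 2 (1 / δ) :=
    Real.logb_nonneg one_lt_two (by rw [le_div_iff₀ hδ]; linarith)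
  have hE₀ : 0 ≤ E := Real.logb_nonneg one_lt_two (by rw [le_div_iff₀ hετ₀]; linarith)
  set r := ⌈Real.logb 2 (1 / δ)⌉₊ with hr
  have hrΛ : (r : ℝ) ≤ 2 * Λ := by
    have h := (Nat.ceil_lt_add_one hδ₀).le
    rw [← hr] at h
    linarith
  have hrδ : (1 / 2 : ℝ) ^ r ≤ δ := by
    have h := Nat.le_ceil (Real.logb 2 (1 / δ))
    rw [Real.logb_le_iff_le_rpow one_lt_two (by positivity), ← hr, Real.rpow_natCast] at h
    rw [one_div, inv_pow]
    exact inv_le_of_inv_le₀ hδ (by rwa [← one_div])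
  have herr₁ : 5 / (((2 ^ κ₁ : ℕ) : ℝ) * (εr * √τ / 4)) ^ 2 ≤ τ / 8 := by
    rw [div_le_iff₀ hετ₀] at hlo₁
    rw [div_le_iff₀ (by positivity)]
    have h : τ / 8 * (((2 ^ κ₁ : ℕ) : ℝ) * (εr * √τ / 4)) ^ 2 =
        (((2 ^ κ₁ : ℕ) : ℝ) * (εr * τ)) ^ 2 / 128 := by
      rw [mul_pow _ (εr * √τ / 4), div_pow, mul_pow εr, Real.sq_sqrt hτ.le]
      ring
    rw [h]
    nlinarith
  have herr₂ : 5 / (((2 ^ κ₂ : ℕ) : ℝ) * (√(τ / 2) / 4)) ^ 2 ≤ 1 / 16 := by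
    rw [div_le_iff₀ hs] at hlo₂
    rw [div_le_iff₀ (by positivity)]
    have h : 1 / 16 * (((2 ^ κ₂ : ℕ) : ℝ) * (√(τ / 2) / 4)) ^ 2 =
        (((2 ^ κ₂ : ℕ) : ℝ) * √τ) ^ 2 / 512 := by
      rw [mul_pow, div_pow, Real.sq_sqrt (by positivity), mul_pow, Real.sq_sqrt hτ.le]
      ring
    rw [h]
    nlinarith
  obtain ⟨A, hA, hcount⟩ := HighDist.exists_solvesRelHighDist (n := n) (a := a) hκ₁ hκ₂ hτ hτ₁
    hε hε₁ herr₁ herr₂ hrδ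
  refine ⟨_, A, hA, ?_, ?_⟩
  · have hpow : τ ^ (3 / 2 : ℝ) = τ * √τ := by
      rw [Real.sqrt_eq_rpow, show (3 / 2 : ℝ) = 1 + 1 / 2 by norm_num, Real.rpow_add hτ,
        Real.rpow_one]
    have hone : (1 : ℝ) ≤ ((2 ^ κ₁ : ℕ) : ℝ) := hB₁.trans hlo₁
    rw [hcount, hpow]
    calc ((r * 2 ^ κ₂ * (2 * (2 ^ κ₁ * 2 + 1)) : ℕ) : ℝ)
        = r * ((2 ^ κ₂ : ℕ) : ℝ) * (2 * (((2 ^ κ₁ : ℕ) : ℝ) * 2 + 1)) := by push_cast; ring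
      _ ≤ 2 * Λ * (2 * (52 / √τ)) * (6 * (2 * (26 / (εr * τ)))) := by
        refine mul_le_mul (mul_le_mul hrΛ hhi₂ (by positivity) (by positivity)) ?_ (by positivity)
          (by positivity)
        linarith
      _ = 64896 * (1 / (εr * (τ * √τ)) * Λ) := by
        field_simp
        ring
  · have hm' : Real.logb 2 m = n := by
      rw [hm]
      push_cast
      rw [Real.logb_pow, Real.logb_self_eq_one one_lt_two, mul_one]
    have hκ₁' : (κ₁ : ℝ) ≤ 6 + E := by
      refine HighDist.le_logb_two_of_pow_le (by positivity) (hhi₁.trans ?_)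
      rw [← mul_div_assoc, ← mul_div_assoc]
      exact div_le_div_of_nonneg_right (by norm_num) hετ₀.le
    -- Here `2 * 52 ≤ 2 ^ 7`, and `1 / √τ ≤ 1 / (εr τ)`.
    have hκ₂' : (κ₂ : ℝ) ≤ 7 + E := by
      refine HighDist.le_logb_two_of_pow_le (by positivity) (hhi₂.trans ?_)
      rw [← mul_div_assoc, ← mul_div_assoc]
      exact div_le_div₀ (by norm_num) (by norm_num) hετ₀ (by nlinarith)
    have hna' : (1 : ℝ) ≤ n + a := by exact_mod_cast hna
    have hr₀ : (0 : ℝ) ≤ r := Nat.cast_nonneg r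
    rw [hm', HighDist.QueryAlgorithm.qubitCount]
    push_cast
    have h₁ : (κ₂ : ℝ) * r ≤ (7 + E) * (2 * Λ) := by gcongr
    -- Since `n + a ≥ 1`, the additive constant is absorbed: `7 + E ≤ 7 (n + E + a)`.
    have h₂ : (7 + E) * (2 * Λ) ≤ 14 * ((n + E + a) * Λ) := by nlinarith
    have h₃ : (n + E + a : ℝ) ≤ (n + E + a) * Λ := le_mul_of_one_le_right (by linarith) hΛ₁
    linarith
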